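/- Let $R$ be a commutative ring and $A,B,d\in R$. A weighted, marked graph $G$ is a finite graph, possibly with loops and with a number $\phi$ of free loops (components without vertices and edges), some of whose vertices are marked, with vertex weights $\alpha,\beta:V(G)\to R$. Let $\mathcal A(G)$ be its Boolean adjacency matrix over $GF(2)$ (with diagonal entry $1$ at looped vertices); for $T\subseteq V(G)$ let $\mathcal A(G)_T$ be obtained by changing the diagonal entries of the elements of $T$ and then removing the row and column of every marked vertex whose diagonal entry is $0$. With $\nu$ the $GF(2)$-nullity, $$[G]=d^{\phi}\sum_{T\subseteq V(G)}\Big(\prod_{v\notin T}\alpha(v)\Big)\Big(\prod_{t\in T}\beta(t)\Big)d^{\nu(\mathcal A(G)_T)}.$$ A vertex is standard if it is unlooped and unmarked and has weights $\alpha=A$, $\beta=B$. If $F,H$ share precisely one vertex $a$, standard in both, the composition $F\ast H$ is obtained from the disjoint union of $F-a$ and $H-a$ by joining every neighbour of $a$ in $F$ to every neighbour of $a$ in $H$; its free loops are those of $F$ and $H$. We say that $\alpha(a),\beta(a),\alpha(a_m)\in R$ are weights for $(F,a)$ if for every $H$ in which no neighbour of $a$ is marked, $[F\ast H]=[H']+[H'_m]$,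 where $H'$ is $H$ with the weights of $a$ changed to $\alpha(a),\beta(a)$, and $H'_m$ is $H$ with $a$ marked and its weights changed to $\alpha(a_m),0$. Let $D$ be an oriented virtual link diagram, and let a circle meet $D$ in precisely four points, none of them a crossing. Let $C$ be a directed Euler system of the universe of $D$ (one directed Euler circuit in each connected component); the crossings at which $C$ does not follow the link are marked. The looped interlacement graph $\mathcal L(D,C)$ has the classical crossings as vertices, looped at negative crossings and marked at marked crossings; two vertices are adjacent if they are interlaced on a circuit of $C$; its number of free loops is one less than the number of connected components of the universe. Let the classical crossings outside the circle have arbitrary weights in $R$. Let $F$ be the graph with a standard vertex $a$ such that $F-a$ is the subgraph of $\mathcal L(D,C)$ induced by the crossings outside the circle; the neighbours of $a$ are the crossings that occur once on each of two different arcs into which the circle cuts a circuit of $C$, both arcs outside the circle; and the free loops of $F$ are the components of the universe that lie entirely outside the circle. Let $D_+$ and $D_-$ be diagrams obtained by replacing the inside of the circle with one positive, respectively negative, classical crossing (and virtual crossings as needed), in such a way that $C$ outside the circle, with the new crossing unmarked, gives Euler systems $C_\pm$ of $D_\pm$. Let $F_\pm=\mathcal L(D_\pm,C_\pm)$, where the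 new crossing has weights $\alpha=A$, $\beta=B$. Then such $D_\pm$ exist, weights for $(F,a)$ exist, and for all such weights and diagrams $$(2-d-d^{2})\,\alpha(a)=-(d+1)[F-a]+\frac{[F_{+}]+[F_{-}]}{A+B},$$ $$(2-d-d^{2})\,\beta(a)=[F-a]+\frac{(A+B+Bd)[F_{+}]-(A+Ad+B)[F_{-}]}{A^{2}-B^{2}},$$ $$(2-d-d^{2})\,\alpha(a_{m})=[F-a]+\frac{(A+B+Bd)[F_{-}]-(A+Ad+B)[F_{+}]}{A^{2}-B^{2}}.$$ Over any $R$ the formulas hold after multiplication by the denominators, and they hold as displayed when the denominators are invertible. -/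

import Mathlib

open scoped Classical

/-! ### Weighted, marked graphs and their bracket polynomials -/

/-- A weighted, marked graph with vertex set `V` and weights in `R`. Only the Boolean adjacency of
a graph matters here, so parallel edges are not recorded. `freeLoops` is the number of free loops,
i.e. of connected components that contain neither vertices nor edges. -/
structure MarkedGraph (R V : Type*) where
  /-- adjacency of distinct vertices -/
  graph : SimpleGraph V
  /-- the looped vertices -/
  looped : V → Prop
  /-- the marked vertices -/
  marked : V → Prop
  /-- the weights `α` -/
  α : V → R
  /-- the weights `β` -/
  β : V → R
  /-- the number of free loops -/
  freeLoops : ℕ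

namespace MarkedGraph

variable {R V W : Type*}

/-- The Boolean adjacency matrix over `GF(2)`, with the diagonal entries of the elements of `T`
changed. -/
noncomputable def toggledMatrix (G : MarkedGraph R V) (T : Finset V) : Matrix V V (ZMod 2) :=
  Matrix.of fun i j =>
    if i = j then (if G.looped i then 1 else 0) + (if i ∈ T then 1 else 0)
    else if G.graph.Adj i j then 1 else 0

/-- The vertices whose rows and columns survive in `𝒜(G)_T`: the row and column of `v` are removed
when `v` is marked and its (changed) diagonal entry is `0`. -/
abbrev Kept (G : MarkedGraph R V) (T : Finset V) : Type _ :=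
  {v : V // ¬ (G.marked v ∧ G.toggledMatrix T v v = 0)}

/-- The matrix `𝒜(G)_T`. -/
noncomputable def stateMatrix (G : MarkedGraph R V) (T : Finset V) :
    Matrix (G.Kept T) (G.Kept T) (ZMod 2) :=
  (G.toggledMatrix T).submatrix Subtype.val Subtype.val

/-- The `GF(2)`-nullity of `𝒜(G)_T`. -/
noncomputable def nullity [Fintype V] (G : MarkedGraph R V) (T : Finset V) : ℕ :=
  Module.finrank (ZMod 2) (LinearMap.ker (G.stateMatrix T).mulVecLin)

/-- The weighted marked-graph bracket polynomial `[G]`. -/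
noncomputable def bracket [CommRing R] [Fintype V] (d : R) (G : MarkedGraph R V) : R :=
  d ^ G.freeLoops *
    ∑ T : Finset V, (∏ v ∈ Tᶜ, G.α v) * (∏ v ∈ T, G.β v) * d ^ G.nullity T

/-- The graph `G - a`. -/
def delete (G : MarkedGraph R V) (a : V) : MarkedGraph R {v : V // v ≠ a} where
  graph := G.graph.comap Subtype.val
  looped v := G.looped v
  marked v := G.marked v
  α v := G.α v
  β v := G.β v
  freeLoops := G.freeLoops

/-- Replace the weights of the vertex `a` by `x` and `y`. -/
noncomputable def reweight (G : MarkedGraph R V) (a : V) (x y : R) : MarkedGraph R V :=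
  { G with α := Function.update G.α a x, β := Function.update G.β a y }

/-- Mark the vertex `a`. -/
def mark (G : MarkedGraph R V) (a : V) : MarkedGraph R V :=
  { G with marked := fun v => v = a ∨ G.marked v }

/-- `a` is unlooped and unmarked and has the standard weights `A` and `B`. -/
def IsStandardVertex (A B : R) (G : MarkedGraph R V) (a : V) : Prop :=
  ¬ G.looped a ∧ ¬ G.marked a ∧ G.α a = A ∧ G.β a = B

/-- The composition `F ∗ H`, where the vertex `a` of `F` is identified with the vertex `b` of `H`
(and `F`, `H` are otherwise disjoint). -/
def compose (F : MarkedGraph R V) (a : V) (H : MarkedGraph R W) (b : W) :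
    MarkedGraph R ({v : V // v ≠ a} ⊕ {w : W // w ≠ b}) where
  graph :=
    { Adj := fun x y =>
        match x, y with
        | .inl v, .inl v' => F.graph.Adj v v'
        | .inr w, .inr w' => H.graph.Adj w w'
        | .inl v, .inr w => F.graph.Adj v a ∧ H.graph.Adj b w
        | .inr w, .inl v => F.graph.Adj v a ∧ H.graph.Adj b w
      symm := ⟨by
        rintro (v | w) (v' | w') h
        · exact F.graph.adj_symm h
        · exact h
        · exact h
        · exact H.graph.adj_symm h⟩
      loopless := ⟨by
        rintro (v | w) h
        · exact F.graph.loopless.irrefl _ h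
        · exact H.graph.loopless.irrefl _ h⟩ }
  looped := Sum.elim (fun v => F.looped v) (fun w => H.looped w)
  marked := Sum.elim (fun v => F.marked v) (fun w => H.marked w)
  α := Sum.elim (fun v => F.α v) (fun w => H.α w)
  β := Sum.elim (fun v => F.β v) (fun w => H.β w)
  freeLoops := F.freeLoops + H.freeLoops

/-- `x`, `y`, `z` can serve as the weights `α(a)`, `β(a)`, `α(a_m)` that `F` and its vertex `a`
determine: for every composition `F ∗ H` with a (finite) graph `H` in which no neighbour of the
common vertex is marked, `[F ∗ H] = [H'] + [H'_m]`, where `H'` is `H` with the weights of the common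
vertex changed to `x`, `y`, and `H'_m` is `H` with the common vertex marked and its weights changed
to `z`, `0`. -/
def IsJoinWeights [CommRing R] [Fintype V] (A B d : R) (F : MarkedGraph R V) (a : V)
    (x y z : R) : Prop :=
  ∀ (W : Type) [Fintype W] (H : MarkedGraph R W) (b : W), H.IsStandardVertex A B b →
    (∀ w, H.graph.Adj b w → ¬ H.marked w) →
    (F.compose a H b).bracket d =
      (H.reweight b x y).bracket d + ((H.mark b).reweight b z 0).bracket d

end MarkedGraph

/-! ### Virtual link diagrams, Euler systems and interlacement -/

/-- An oriented virtual link diagram with set `V` of classical crossings, given by its signed Gauss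
code (virtual crossings carry no data), on which a set `P` of points that are not crossings has been
singled out. The link runs through the classical crossing `v` twice, along the overpassing strand
`(v, true)` and along the underpassing strand `(v, false)`. A node is such a passage or a point of
`P`, and `next x` is the node that the link meets after `x`. -/
structure LinkDiagram (V P : Type*) where
  /-- the node reached along the arc that leaves a node -/
  next : Equiv.Perm (V × Bool ⊕ P)
  /-- the negative crossings -/
  negative : V → Prop
  /-- the number of link components that carry neither classical crossings nor points of `P` -/
  freeLoops : ℕ

/-- `x`, `y`, `z`, `w` are distinct elements of one cycle of `σ`, met in this cyclic order. -/
def InCyclicOrder {N : Type*} (σ : Equiv.Perm N) (x y z w : N) : Prop :=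
  ∃ i j k : ℕ, 0 < i ∧ i < j ∧ j < k ∧ k < Function.minimalPeriod σ x ∧
    σ^[i] x = y ∧ σ^[j] x = z ∧ σ^[k] x = w

/-- Some cycle of `σ` meets the pairs `{x, x'}` and `{y, y'}` alternately. -/
def Alternate {N : Type*} (σ : Equiv.Perm N) (x x' y y' : N) : Prop :=
  InCyclicOrder σ x y x' y' ∨ InCyclicOrder σ x y' x' y

namespace LinkDiagram

variable {R V P : Type*}

/-- At a crossing in `M`, change to the other strand. -/
def switch (M : V → Bool) : Equiv.Perm (V × Bool ⊕ P) where
  toFun := Sum.map (fun x => (x.1, xor x.2 (M x.1))) id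
  invFun := Sum.map (fun x => (x.1, xor x.2 (M x.1))) id
  left_inv := by rintro (⟨v, s⟩ | p) <;> simp
  right_inv := by rintro (⟨v, s⟩ | p) <;> simp

/-- The directed circuits in the universe that follow the link except at the crossings in `M`, where
they arrive along one strand and leave along the other one: the circuits are the cycles of this
permutation (together with the free loops). -/
def circuits (D : LinkDiagram V P) (M : V → Bool) : Equiv.Perm (V × Bool ⊕ P) :=
  (switch M).trans D.next

/-- Two nodes are linked when an arc joins them or when they are the two passages through one
crossing. -/
inductive Linked (D : LinkDiagram V P) : V × Bool ⊕ P → V × Bool ⊕ P → Prop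
  | arc (x) : Linked D x (D.next x)
  | crossing (v) : Linked D (.inl (v, false)) (.inl (v, true))

/-- The connected components of the universe, other than the free loops. -/
def Component (D : LinkDiagram V P) : Type _ := Quot D.Linked

/-- The component of a node. -/
def component (D : LinkDiagram V P) (x : V × Bool ⊕ P) : D.Component := Quot.mk _ x

/-- The circuits that `M` determines form a directed Euler system: there is exactly one of them in
each connected component of the universe (and `M` is its set of marked crossings). -/
def IsEulerSystem (D : LinkDiagram V P) (M : V → Bool) : Prop :=
  ∀ x y, D.component x = D.component y ↔ (D.circuits M).SameCycle x y

/-- Two crossings are interlaced if they appear on a circuit in the order `v … w … v … w …`. -/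
def Interlaced (D : LinkDiagram V P) (M : V → Bool) (v w : V) : Prop :=
  Alternate (D.circuits M) (.inl (v, false)) (.inl (v, true)) (.inl (w, false)) (.inl (w, true))

/-- The looped interlacement graph `ℒ(D, C)` of a (nonempty) diagram with crossing weights `α`, `β`,
where `M` is the set of marked crossings of the Euler system `C`. It has one free loop less than the
universe has connected components, so that `[ℒ(D, C)]` is the Kauffman bracket of `D`. -/
noncomputable def interlacementGraph (D : LinkDiagram V P) (M : V → Bool) (α β : V → R) :
    MarkedGraph R V where
  graph := SimpleGraph.fromRel (D.Interlaced M)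
  looped := D.negative
  marked v := M v = true
  α := α
  β := β
  freeLoops := Nat.card D.Component + D.freeLoops - 1

end LinkDiagram

/-! ### Tangles -/

/-- A directed (virtual) tangle with set `V` of classical crossings: the part of an oriented link
diagram on one side of a circle that meets the diagram in exactly four points, none of them a
crossing. The link enters this side of the circle at two of the points and leaves it at the two
others, both numbered by `Bool`. `arc` sends the start of an arc (a passage through a crossing, or a
point of entry) to its end (a passage through a crossing, or an exit). -/
structure Tangle (V : Type*) where
  /-- the end of the arc with the given start -/
  arc : V × Bool ⊕ Bool ≃ V × Bool ⊕ Bool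
  /-- the negative crossings -/
  negative : V → Prop
  /-- the number of link components inside the tangle without classical crossings -/
  freeLoops : ℕ

namespace Tangle

variable {R V W : Type*}

/-- The nodes of a diagram divided by a circle, as starts of arcs. The points of the circle are
`inl i` (the link passes from outside to inside) and `inr o` (from inside to outside). -/
def startEquiv : (V ⊕ W) × Bool ⊕ (Bool ⊕ Bool) ≃ (V × Bool ⊕ Bool) ⊕ (W × Bool ⊕ Bool) where
  toFun
    | .inl (.inl v, s) => .inl (.inl (v, s))
    | .inl (.inr w, s) => .inr (.inl (w, s))
    | .inr (.inl i) => .inr (.inr i)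
    | .inr (.inr o) => .inl (.inr o)
  invFun
    | .inl (.inl (v, s)) => .inl (.inl v, s)
    | .inr (.inl (w, s)) => .inl (.inr w, s)
    | .inr (.inr i) => .inr (.inl i)
    | .inl (.inr o) => .inr (.inr o)
  left_inv := by rintro (⟨v | w, s⟩ | i | o) <;> rfl
  right_inv := by rintro ((⟨v, s⟩ | o) | ⟨w, s⟩ | i) <;> rfl

/-- The nodes of a diagram divided by a circle, as ends of arcs. -/
def endEquiv : (V ⊕ W) × Bool ⊕ (Bool ⊕ Bool) ≃ (V × Bool ⊕ Bool) ⊕ (W × Bool ⊕ Bool) where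
  toFun
    | .inl (.inl v, s) => .inl (.inl (v, s))
    | .inl (.inr w, s) => .inr (.inl (w, s))
    | .inr (.inl i) => .inl (.inr i)
    | .inr (.inr o) => .inr (.inr o)
  invFun
    | .inl (.inl (v, s)) => .inl (.inl v, s)
    | .inr (.inl (w, s)) => .inl (.inr w, s)
    | .inl (.inr i) => .inr (.inl i)
    | .inr (.inr o) => .inr (.inr o)
  left_inv := by rintro (⟨v | w, s⟩ | i | o) <;> rfl
  right_inv := by rintro ((⟨v, s⟩ | o) | ⟨w, s⟩ | i) <;> rfl

/-- The link diagram with the tangle `T` outside and the tangle `S` inside a circle. The exit `i` of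
`T` is the entry `i` of `S`, and the exit `o` of `S` is the entry `o` of `T`; the four points on the
circle are the distinguished points of the diagram. -/
def glue (T : Tangle V) (S : Tangle W) : LinkDiagram (V ⊕ W) (Bool ⊕ Bool) where
  next := (startEquiv.trans (Equiv.sumCongr T.arc S.arc)).trans endEquiv.symm
  negative := Sum.elim T.negative S.negative
  freeLoops := T.freeLoops + S.freeLoops

/-- The tangle with a single classical crossing: the strand that comes in at `i` becomes the strand
`f i` of the crossing, and the strand `s` of the crossing goes out at `g s`. (In a drawing this may
need virtual crossings.) -/
def oneCrossing (isNegative : Prop) (f g : Equiv.Perm Bool) : Tangle Unit where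
  arc :=
    { toFun := fun
        | .inl (_, s) => .inr (g s)
        | .inr i => .inl ((), f i)
      invFun := fun
        | .inl (_, s) => .inr (f.symm s)
        | .inr o => .inl ((), g.symm o)
      left_inv := by rintro (⟨v, s⟩ | i) <;> simp
      right_inv := by rintro (⟨v, s⟩ | i) <;> simp }
  negative _ := isNegative
  freeLoops := 0

/-- The graph `F`, with `a = none`, that arises from the tangle `T` outside a circle in the diagram
`D = glue T S` with the Euler system `C` whose marked crossings are `M`. Here `F - a` is the subgraph
of `ℒ(D, C)` induced by the crossings outside the circle. The neighbours of `a` are the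
crossings that appear on both of the paths that a circuit of `C` follows outside the circle, i.e.
those that appear alternately on a circuit with the two points where the link enters the circle; if
these two points lie on different circuits there are none. The free loops are the components of the
universe that lie outside the circle. The vertex `a` is unlooped and unmarked and has the standard
weights `A`, `B`; the crossings outside the circle have the weights `α`, `β`. -/
noncomputable def outsideGraph (T : Tangle V) (S : Tangle W) (M : V ⊕ W → Bool)
    (A B : R) (α β : V → R) : MarkedGraph R (Option V) where
  graph := SimpleGraph.fromRel fun x y =>
    match x, y with
    | some v, some w => (glue T S).Interlaced M (.inl v) (.inl w)
    | none, some v =>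
        Alternate ((glue T S).circuits M) (.inr (.inl false)) (.inr (.inl true))
          (.inl (.inl v, false)) (.inl (.inl v, true))
    | _, none => False
  looped x := ∃ v, x = some v ∧ T.negative v
  marked x := ∃ v, x = some v ∧ M (.inl v) = true
  α x := x.elim A α
  β x := x.elim B β
  freeLoops := T.freeLoops + Nat.card {c : (glue T S).Component //
    (∃ v : V, (glue T S).component (.inl (.inl v, false)) = c) ∧
      ∀ p, (glue T S).component (.inr p) ≠ c}

/-- The diagram obtained by closing the tangle `T`, which lies outside a circle, with a single
classical crossing inside the circle: `D₊` (`isNegative` false) or `D₋` (`isNegative` true). -/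
def closure (T : Tangle V) (isNegative : Prop) (f g : Equiv.Perm Bool) :
    LinkDiagram (V ⊕ Unit) (Bool ⊕ Bool) :=
  glue T (oneCrossing isNegative f g)

/-- The marks of `C` at the crossings outside the circle, with the new crossing unmarked. -/
def closedMarks (M : V ⊕ W → Bool) : V ⊕ Unit → Bool :=
  Sum.elim (fun v => M (.inl v)) (fun _ => false)

/-- The Euler system `C` with set `M` of marked crossings gives rise to an Euler system `C₊` or `C₋`
of `D₊` or `D₋`, which is the same outside the circle and follows the link at the new crossing. -/
def IsCompatible (T : Tangle V) (M : V ⊕ W → Bool) (isNegative : Prop) (f g : Equiv.Perm Bool) :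
    Prop :=
  (T.closure isNegative f g).IsEulerSystem (closedMarks M)

/-- The graph `F₊ = ℒ(D₊, C₊)` or `F₋ = ℒ(D₋, C₋)`. The new crossing has the standard weights `A`,
`B`. -/
noncomputable def closedGraph (T : Tangle V) (M : V ⊕ W → Bool) (isNegative : Prop)
    (f g : Equiv.Perm Bool) (A B : R) (α β : V → R) : MarkedGraph R (V ⊕ Unit) :=
  (T.closure isNegative f g).interlacementGraph (closedMarks M)
    (Sum.elim α fun _ => A) (Sum.elim β fun _ => B)

end Tangle

/-! For a fixed state of `F - a`, the matrix of a state of `F ∗ H` consists of a block `P` from `F -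
a`, a block `Q` from `H - a`, and the rank one coupling of their neighbour vectors `a`, `b`.
Symmetric elimination over GF(2) leaves three cases: `a = P w` with `w ⬝ᵥ P w = 0`, `a = P w` with
`w ⬝ᵥ P w = 1`, or `a` outside the range of `P`. Up to a constant that depends on `P` and `a` only,
the nullity is then that of `Q` alone, of `Q` bordered by `b` with corner `1`, or of `Q` bordered
with corner `0`. These are the states of `H` with the common vertex marked and deleted, toggled, or
untouched. Collecting coefficients over the states of `F - a` gives the weights `z`, `y`, `x`
(`exists_isJoinWeights`).

Any such weights satisfy three linear equations, obtained from three test graphs `H`: a single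
vertex, giving `[F - a]`, and an edge whose far end is unlooped or looped. Composing with an edge
replaces `a` by the far end, with the same neighbours, which is the graph of the closed diagram
(`bracket_closedGraph`). The formulas are the solution of this system.

The topological point is that the inside of the circle affects the circuits outside only through a
permutation of two points (`exists_isFirstReturn_returnPerm`). Closing with an unmarked crossing
either keeps this permutation or composes it with a transposition. The latter happens only if it
merges two circuits, which changes neither the interlacement of outside crossings nor the number of
components avoiding the circle. -/

/-! ### Nullity over GF(2) of blocks with a rank one coupling. -/

namespace Matrix

variable {m n : Type*} [Fintype m] [Fintype n]

/-- The nullity of a square matrix over `GF(2)`. -/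
noncomputable def nullity₂ (M : Matrix m m (ZMod 2)) : ℕ :=
  Module.finrank (ZMod 2) (LinearMap.ker M.mulVecLin)

theorem nullity₂_submatrix (M : Matrix m m (ZMod 2)) (e : n ≃ m) :
    (M.submatrix e e).nullity₂ = M.nullity₂ := by
  refine LinearEquiv.finrank_eq
    { toFun := fun x => ⟨x.1 ∘ e.symm, ?_⟩
      invFun := fun x => ⟨x.1 ∘ e, ?_⟩
      map_add' := fun x y => rfl
      map_smul' := fun c x => rfl
      left_inv := fun x => by ext; simp
      right_inv := fun x => by ext; simp }
  · have h := x.2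
    simp only [LinearMap.mem_ker, mulVecLin_apply] at h ⊢
    rw [submatrix_mulVec_equiv] at h
    ext i
    simpa using congrFun h (e.symm i)
  · have h := x.2
    simp only [LinearMap.mem_ker, mulVecLin_apply] at h ⊢
    rw [submatrix_mulVec_equiv]
    ext i
    simpa [Function.comp_assoc] using congrFun h (e i)

/-- For explicit small matrices the kernel can be counted by `decide`. -/
theorem nullity₂_eq_of_card (M : Matrix m m (ZMod 2)) (k : ℕ)
    (h : Nat.card {v : m → ZMod 2 // M.mulVec v = 0} = 2 ^ k) : M.nullity₂ = k := by
  have h1 : Nat.card (LinearMap.ker M.mulVecLin) = 2 ^ k := h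
  rw [Module.natCard_eq_pow_finrank (K := ZMod 2), Nat.card_zmod] at h1
  exact Nat.pow_right_injective le_rfl h1

/-- The adjacency matrix of a composition: the blocks `P` and `Q` are connected by the rank one
matrix that `a` and `b` define. -/
def compose (P : Matrix m m (ZMod 2)) (a : m → ZMod 2) (Q : Matrix n n (ZMod 2))
    (b : n → ZMod 2) : Matrix (m ⊕ n) (m ⊕ n) (ZMod 2) :=
  fromBlocks P (vecMulVec a b) (vecMulVec b a) Q

theorem mem_ker_compose {P : Matrix m m (ZMod 2)} {a : m → ZMod 2} {Q : Matrix n n (ZMod 2)}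
    {b : n → ZMod 2} {x : m ⊕ n → ZMod 2} :
    x ∈ LinearMap.ker (compose P a Q b).mulVecLin ↔
      P.mulVec (x ∘ Sum.inl) + (b ⬝ᵥ (x ∘ Sum.inr)) • a = 0 ∧
        (a ⬝ᵥ (x ∘ Sum.inl)) • b + Q.mulVec (x ∘ Sum.inr) = 0 := by
  rw [LinearMap.mem_ker, mulVecLin_apply, compose, fromBlocks_mulVec]
  constructor
  · intro hx
    refine ⟨?_, ?_⟩
    · ext i
      simpa [vecMulVec_mulVec, mul_comm] using congrFun hx (Sum.inl i)
    · ext i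
      simpa [vecMulVec_mulVec, mul_comm] using congrFun hx (Sum.inr i)
  · rintro ⟨h1, h2⟩
    ext (i | i)
    · simpa [vecMulVec_mulVec, mul_comm] using congrFun h1 i
    · simpa [vecMulVec_mulVec, mul_comm] using congrFun h2 i

/-- Adding `(b ⬝ᵥ y) • w` to the first component of a vector clears the coupling. By symmetry of `P`
the two blocks separate, at the cost of a rank one correction to `Q`. -/
theorem nullity₂_compose_of_mulVec {P : Matrix m m (ZMod 2)} (hP : P.IsSymm) (w : m → ZMod 2)
    (Q : Matrix n n (ZMod 2)) (b : n → ZMod 2) :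
    (compose P (P.mulVec w) Q b).nullity₂ =
      P.nullity₂ + (Q - (w ⬝ᵥ P.mulVec w) • vecMulVec b b).nullity₂ := by
  have hs : ∀ u, P.mulVec w ⬝ᵥ u = w ⬝ᵥ P.mulVec u := fun u => by
    rw [dotProduct_mulVec, ← mulVec_transpose, hP.eq]
  have hQ : ∀ v : n → ZMod 2, (Q - (w ⬝ᵥ P.mulVec w) • vecMulVec b b).mulVec v =
      Q.mulVec v - ((w ⬝ᵥ P.mulVec w) * (b ⬝ᵥ v)) • b := by
    intro v
    ext i
    simp [sub_mulVec, smul_mulVec, vecMulVec_mulVec]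
    ring
  have hto : ∀ x ∈ LinearMap.ker (compose P (P.mulVec w) Q b).mulVecLin,
      x ∘ Sum.inl + (b ⬝ᵥ (x ∘ Sum.inr)) • w ∈ LinearMap.ker P.mulVecLin ∧ x ∘ Sum.inr ∈
        LinearMap.ker (Q - (w ⬝ᵥ P.mulVec w) • vecMulVec b b).mulVecLin := by
    intro x hx
    obtain ⟨h1, h2⟩ := mem_ker_compose.1 hx
    refine ⟨by simpa [mulVec_add, mulVec_smul] using h1, ?_⟩
    rw [LinearMap.mem_ker, mulVecLin_apply, hQ]
    have h3 : w ⬝ᵥ P.mulVec (x ∘ Sum.inl) = -((w ⬝ᵥ P.mulVec w) * (b ⬝ᵥ (x ∘ Sum.inr))) := by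
      rw [eq_neg_of_add_eq_zero_left h1]
      simp [mul_comm]
    rw [hs, h3, neg_smul] at h2
    rw [← h2, sub_eq_neg_add]
  have hinv : ∀ u ∈ LinearMap.ker P.mulVecLin,
      ∀ v ∈ LinearMap.ker (Q - (w ⬝ᵥ P.mulVec w) • vecMulVec b b).mulVecLin,
      Sum.elim (u - (b ⬝ᵥ v) • w) v ∈ LinearMap.ker (compose P (P.mulVec w) Q b).mulVecLin := by
    intro u h1 v h2
    rw [LinearMap.mem_ker, mulVecLin_apply] at h1 h2
    rw [hQ] at h2
    rw [mem_ker_compose]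
    simp only [Sum.elim_comp_inl, Sum.elim_comp_inr, mulVec_sub, mulVec_smul, h1, hs]
    exact ⟨by simp, by simpa [sub_eq_neg_add, mul_comm, ZModModule.neg_eq_self] using h2⟩
  rw [nullity₂, nullity₂, nullity₂, ← Module.finrank_prod]
  exact LinearEquiv.finrank_eq
    { toFun := fun x => (⟨_, (hto x.1 x.2).1⟩, ⟨_, (hto x.1 x.2).2⟩)
      invFun := fun y => ⟨_, hinv y.1.1 y.1.2 y.2.1 y.2.2⟩
      map_add' := fun x y => by
        have h : (x.1 + y.1) ∘ (Sum.inr : n → m ⊕ n) = x.1 ∘ Sum.inr + y.1 ∘ Sum.inr := rfl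
        ext i
        · simp [h, dotProduct_add]
          ring
        · simp
      map_smul' := fun c x => by
        have h : (c • x.1) ∘ (Sum.inr : n → m ⊕ n) = c • (x.1 ∘ Sum.inr) := rfl
        ext i
        · simp [h, mul_assoc]
        · simp
      left_inv := fun x => by ext (i | i) <;> simp
      right_inv := fun y => by ext i <;> simp }

/-- Null vectors orthogonal to `a`. -/
def orthogonalKer (P : Matrix m m (ZMod 2)) (a : m → ZMod 2) : Submodule (ZMod 2) (m → ZMod 2) where
  carrier := {u | P.mulVec u = 0 ∧ a ⬝ᵥ u = 0}
  add_mem' := fun hu hv => by simp_all [mulVec_add]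
  zero_mem' := by simp
  smul_mem' := fun c u hu => by simp_all [mulVec_smul]

/-- Pairing the first block equation with `u` forces `b ⬝ᵥ y = 0`, hence `P x = 0`. Then `x` splits
along `u` into a part orthogonal to `a` and the scalar `a ⬝ᵥ x`, and this scalar acts on `Q` like a
one-vertex block with entry `0`. -/
theorem nullity₂_compose_of_ker {P : Matrix m m (ZMod 2)} (hP : P.IsSymm) {a u : m → ZMod 2}
    (hu : P.mulVec u = 0) (hau : a ⬝ᵥ u = 1) (Q : Matrix n n (ZMod 2)) (b : n → ZMod 2) :
    (compose P a Q b).nullity₂ = Module.finrank (ZMod 2) (orthogonalKer P a) +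
      (compose (0 : Matrix Unit Unit (ZMod 2)) 1 Q b).nullity₂ := by
  have hs : ∀ v, u ⬝ᵥ P.mulVec v = 0 := fun v => by
    rw [dotProduct_mulVec, ← mulVec_transpose, hP.eq, hu, zero_dotProduct]
  have hua : u ⬝ᵥ a = 1 := by rw [dotProduct_comm, hau]
  have key : ∀ {x : m ⊕ n → ZMod 2}, x ∈ LinearMap.ker (compose P a Q b).mulVecLin →
      b ⬝ᵥ (x ∘ Sum.inr) = 0 ∧ P.mulVec (x ∘ Sum.inl) = 0 := by
    intro x hx
    have h1 := (mem_ker_compose.1 hx).1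
    have h2 := congrArg (u ⬝ᵥ ·) h1
    simp [dotProduct_add, hs, hua] at h2
    rw [h2] at h1
    exact ⟨h2, by simpa using h1⟩
  have hto : ∀ x ∈ LinearMap.ker (compose P a Q b).mulVecLin,
      x ∘ Sum.inl - (a ⬝ᵥ (x ∘ Sum.inl)) • u ∈ orthogonalKer P a ∧
      (Sum.elim (fun _ => a ⬝ᵥ (x ∘ Sum.inl)) (x ∘ Sum.inr) : Unit ⊕ n → ZMod 2) ∈
        LinearMap.ker (compose (0 : Matrix Unit Unit (ZMod 2)) 1 Q b).mulVecLin := by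
    intro x hx
    obtain ⟨h1, h2⟩ := key hx
    have h3 := (mem_ker_compose.1 hx).2
    refine ⟨⟨by simp [mulVec_sub, mulVec_smul, h2, hu], by simp [dotProduct_sub, hau]⟩, ?_⟩
    rw [mem_ker_compose]
    simp only [Sum.elim_comp_inl, Sum.elim_comp_inr, h1]
    refine ⟨by simp, ?_⟩
    rw [← h3]
    simp [dotProduct]
  have hinv : ∀ v ∈ orthogonalKer P a,
      ∀ y ∈ LinearMap.ker (compose (0 : Matrix Unit Unit (ZMod 2)) 1 Q b).mulVecLin,
      Sum.elim (v + y (Sum.inl ()) • u) (y ∘ Sum.inr) ∈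
        LinearMap.ker (compose P a Q b).mulVecLin := by
    rintro v ⟨h1, h2⟩ y hy
    obtain ⟨h3, h4⟩ := mem_ker_compose.1 hy
    have h5 : b ⬝ᵥ (y ∘ Sum.inr) = 0 := by simpa using congrFun h3 ()
    rw [mem_ker_compose]
    simp only [Sum.elim_comp_inl, Sum.elim_comp_inr, h5]
    refine ⟨by simp [mulVec_add, mulVec_smul, h1, hu], ?_⟩
    rw [← h4, dotProduct_add, dotProduct_smul, h2, hau]
    simp [dotProduct]
  rw [nullity₂, nullity₂, ← Module.finrank_prod]
  exact LinearEquiv.finrank_eq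
    { toFun := fun x => (⟨_, (hto x.1 x.2).1⟩, ⟨_, (hto x.1 x.2).2⟩)
      invFun := fun y => ⟨_, hinv y.1.1 y.1.2 y.2.1 y.2.2⟩
      map_add' := fun x y => by
        have h : (x.1 + y.1) ∘ (Sum.inl : m → m ⊕ n) = x.1 ∘ Sum.inl + y.1 ∘ Sum.inl := rfl
        ext i
        · simp [h, dotProduct_add]
          ring
        · rcases i with i | i <;> simp [h, dotProduct_add]
      map_smul' := fun c x => by
        have h : (c • x.1) ∘ (Sum.inl : m → m ⊕ n) = c • (x.1 ∘ Sum.inl) := rfl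
        ext i
        · simp [h, mul_sub, mul_assoc]
        · rcases i with i | i <;> simp [h]
      left_inv := fun x => by ext (i | i) <;> simp
      right_inv := fun y => by
        have h1 := y.1.2.2
        ext i
        · simp [dotProduct_add, h1, hau]
        · rcases i with i | i <;> simp [dotProduct_add, h1, hau] }

/-- A functional that vanishes on the range of `P` but not at `a` is represented by a vector, which
symmetry puts in the kernel. Over GF(2) its nonzero value at `a` is `1`. -/
theorem exists_ker_of_notMem_range {P : Matrix m m (ZMod 2)} (hP : P.IsSymm) {a : m → ZMod 2}
    (ha : ¬ ∃ w, P.mulVec w = a) : ∃ u, P.mulVec u = 0 ∧ a ⬝ᵥ u = 1 := by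
  have ha' : a ∉ LinearMap.range P.mulVecLin := by simpa using ha
  obtain ⟨f, hf, hle⟩ := Submodule.exists_le_ker_of_notMem ha'
  refine ⟨fun i => f (Pi.single i 1), ?_, ?_⟩
  · have hfv : ∀ v : m → ZMod 2, f v = (fun i => f (Pi.single i 1)) ⬝ᵥ v := by
      intro v
      conv_lhs => rw [pi_eq_sum_univ' v]
      simp [dotProduct, mul_comm]
    rw [← hP.eq, mulVec_transpose]
    refine dotProduct_eq_zero _ fun v => ?_
    rw [← dotProduct_mulVec, ← hfv]
    exact hle ⟨v, rfl⟩
  · have hfv : ∀ v : m → ZMod 2, f v = v ⬝ᵥ (fun i => f (Pi.single i 1)) := by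
      intro v
      conv_lhs => rw [pi_eq_sum_univ' v]
      simp [dotProduct]
    rw [← hfv]
    exact Fin.eq_one_of_ne_zero _ hf

/-- The power of `d` that a state of `F ∗ H` contributes depends on `H` through the nullities of
three matrices only. -/
theorem exists_coeff_pow_nullity₂_compose {R : Type*} [CommRing R] (d : R)
    {P : Matrix m m (ZMod 2)} (hP : P.IsSymm) (a : m → ZMod 2) :
    ∃ x y z : R, ∀ (n : Type) [Fintype n] (Q : Matrix n n (ZMod 2)) (b : n → ZMod 2),
      d ^ (compose P a Q b).nullity₂ =
        x * d ^ (compose (0 : Matrix Unit Unit (ZMod 2)) 1 Q b).nullity₂ +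
        y * d ^ (compose (1 : Matrix Unit Unit (ZMod 2)) 1 Q b).nullity₂ + z * d ^ Q.nullity₂ := by
  by_cases ha : ∃ w, P.mulVec w = a
  · obtain ⟨w, rfl⟩ := ha
    rcases (by decide : ∀ c : ZMod 2, c = 0 ∨ c = 1) (w ⬝ᵥ P.mulVec w) with hc | hc
    · refine ⟨0, 0, d ^ P.nullity₂, fun n _ Q b => ?_⟩
      rw [nullity₂_compose_of_mulVec hP, hc]
      simp [pow_add]
    · refine ⟨0, d ^ P.nullity₂, 0, fun n _ Q b => ?_⟩
      -- The one-vertex block with entry `1` has the same rank one correction, so both nullities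
      -- reduce to that of `Q - vecMulVec b b`.
      have h1 := nullity₂_compose_of_mulVec (Matrix.isSymm_one (n := Unit)) 1 Q b
      have h0 : (1 : Matrix Unit Unit (ZMod 2)).nullity₂ = 0 := by
        have h : LinearMap.ker (1 : Matrix Unit Unit (ZMod 2)).mulVecLin = ⊥ := by simp
        rw [nullity₂, h, finrank_bot]
      rw [nullity₂_compose_of_mulVec hP, hc]
      rw [one_mulVec, h0, zero_add] at h1
      rw [h1]
      simp [pow_add, dotProduct]
  · obtain ⟨u, hu, hau⟩ := exists_ker_of_notMem_range hP ha
    refine ⟨d ^ Module.finrank (ZMod 2) (orthogonalKer P a), 0, 0, fun n _ Q b => ?_⟩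
    rw [nullity₂_compose_of_ker hP hu hau]
    simp [pow_add]

end Matrix

theorem Matrix.nullity₂_compose_submatrix {m m' n n' : Type*} [Fintype m] [Fintype m']
    [Fintype n] [Fintype n'] (P : Matrix m m (ZMod 2)) (a : m → ZMod 2) (Q : Matrix n n (ZMod 2))
    (b : n → ZMod 2) (e : m' ≃ m) (f : n' ≃ n) :
    (compose (P.submatrix e e) (a ∘ e) (Q.submatrix f f) (b ∘ f)).nullity₂ =
      (compose P a Q b).nullity₂ := by
  rw [← nullity₂_submatrix (compose P a Q b) (Equiv.sumCongr e f)]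
  congr 1
  ext (i | i) (j | j) <;> rfl

/-! ### Brackets of joins and the existence of weights. -/

namespace MarkedGraph

variable {R V W X Y : Type*}

/-- The product of the weights that belongs to the state `T`. -/
noncomputable def stateWeight [CommRing R] [Fintype V] (G : MarkedGraph R V) (T : Finset V) : R :=
  ∏ v, if v ∈ T then G.β v else G.α v

/-- A single product over all vertices factors over a disjoint union of vertex sets. -/
theorem bracket_eq_sum_stateWeight [CommRing R] [Fintype V] (d : R) (G : MarkedGraph R V) :
    G.bracket d =
      d ^ G.freeLoops * ∑ T, G.stateWeight T * d ^ (G.stateMatrix T).nullity₂ := by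
  rw [bracket]
  congr 1
  refine Finset.sum_congr rfl fun T _ => ?_
  rw [stateWeight, Finset.prod_ite, mul_comm (∏ v ∈ Tᶜ, G.α v)]
  have h1 : Finset.univ.filter (fun v => v ∈ T) = T := by ext; simp
  have h2 : Finset.univ.filter (fun v => v ∉ T) = Tᶜ := by ext; simp
  rw [h1, h2]
  rfl

theorem bracket_congr [CommRing R] [Fintype V] [Fintype W] (d : R) (e : V ≃ W)
    {G : MarkedGraph R V} {H : MarkedGraph R W}
    (hadj : ∀ u v, H.graph.Adj (e u) (e v) ↔ G.graph.Adj u v)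
    (hlooped : ∀ v, H.looped (e v) ↔ G.looped v) (hmarked : ∀ v, H.marked (e v) ↔ G.marked v)
    (hα : ∀ v, H.α (e v) = G.α v) (hβ : ∀ v, H.β (e v) = G.β v)
    (hfree : H.freeLoops = G.freeLoops) : G.bracket d = H.bracket d := by
  rw [bracket_eq_sum_stateWeight, bracket_eq_sum_stateWeight, hfree]
  congr 1
  refine Fintype.sum_equiv e.finsetCongr _ _ fun T => ?_
  have ht : ∀ u v, H.toggledMatrix (e.finsetCongr T) (e u) (e v) = G.toggledMatrix T u v := by
    intro u v
    simp [toggledMatrix, hadj, hlooped]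
  congr 1
  · refine Fintype.prod_equiv e _ _ fun v => ?_
    simp [hα, hβ]
  · congr 1
    have hk : ∀ v, ¬ (G.marked v ∧ G.toggledMatrix T v v = 0) ↔
        ¬ (H.marked (e v) ∧ H.toggledMatrix (e.finsetCongr T) (e v) (e v) = 0) := fun v => by
      rw [ht, hmarked]
    rw [← Matrix.nullity₂_submatrix (H.stateMatrix (e.finsetCongr T)) (e.subtypeEquiv hk)]
    congr 1
    ext u v
    exact (ht u v).symm

/-- Two graphs connected by all edges between the vertices in `N` and those in `N'`. -/
def join (G : MarkedGraph R X) (N : X → Prop) (H : MarkedGraph R Y) (N' : Y → Prop) :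
    MarkedGraph R (X ⊕ Y) where
  graph :=
    { Adj := fun x y =>
        match x, y with
        | .inl v, .inl v' => G.graph.Adj v v'
        | .inr w, .inr w' => H.graph.Adj w w'
        | .inl v, .inr w => N v ∧ N' w
        | .inr w, .inl v => N v ∧ N' w
      symm := ⟨by
        rintro (v | w) (v' | w') h
        · exact G.graph.adj_symm h
        · exact h
        · exact h
        · exact H.graph.adj_symm h⟩
      loopless := ⟨by
        rintro (v | w) h
        · exact G.graph.loopless.irrefl _ h
        · exact H.graph.loopless.irrefl _ h⟩ }
  looped := Sum.elim G.looped H.looped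
  marked := Sum.elim G.marked H.marked
  α := Sum.elim G.α H.α
  β := Sum.elim G.β H.β
  freeLoops := G.freeLoops + H.freeLoops

/-- The indicator vector of `N` on the vertices that survive in `𝒜(G)_T`. -/
noncomputable def keptIndicator (G : MarkedGraph R V) (N : V → Prop) (T : Finset V) :
    G.Kept T → ZMod 2 :=
  fun v => if N v then 1 else 0

theorem toggledMatrix_isSymm (G : MarkedGraph R V) (T : Finset V) :
    (G.toggledMatrix T).IsSymm := by
  ext i j
  by_cases h : i = j
  · rw [h, Matrix.transpose_apply]
  · simp [toggledMatrix, h, Ne.symm h, G.graph.adj_comm]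

theorem stateMatrix_isSymm (G : MarkedGraph R V) (T : Finset V) :
    (G.stateMatrix T).IsSymm :=
  (G.toggledMatrix_isSymm T).submatrix _

/-- A state of the join is a pair of states. Diagonal entries do not see the connecting edges, so
the surviving vertices split accordingly and the state matrix is a `Matrix.compose`. -/
theorem bracket_join [CommRing R] [Fintype X] [Fintype Y] (d : R) (G : MarkedGraph R X)
    (N : X → Prop) (H : MarkedGraph R Y) (N' : Y → Prop) :
    (G.join N H N').bracket d = d ^ (G.freeLoops + H.freeLoops) *
      ∑ T, ∑ U, G.stateWeight T * H.stateWeight U *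
        d ^ (Matrix.compose (G.stateMatrix T) (G.keptIndicator N T) (H.stateMatrix U)
          (H.keptIndicator N' U)).nullity₂ := by
  rw [bracket_eq_sum_stateWeight]
  congr 1
  rw [← Fintype.sum_prod_type']
  symm
  refine Fintype.sum_equiv Finset.sumEquiv.symm.toEquiv _ _ ?_
  rintro ⟨T, U⟩
  simp only [RelIso.coe_fn_toEquiv]
  symm
  congr 1
  · simp [stateWeight, join, Fintype.prod_sum_type, Finset.sumEquiv]
  · congr 1
    have hl : ∀ u v, (G.join N H N').toggledMatrix (Finset.sumEquiv.symm (T, U)) (.inl u) (.inl v) =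
        G.toggledMatrix T u v := by
      intro u v
      simp only [toggledMatrix, join, Finset.sumEquiv, Matrix.of_apply]
      by_cases h : u = v <;> simp [h]
      congr!
    have hr : ∀ u v, (G.join N H N').toggledMatrix (Finset.sumEquiv.symm (T, U)) (.inr u) (.inr v) =
        H.toggledMatrix U u v := by
      intro u v
      simp only [toggledMatrix, join, Finset.sumEquiv, Matrix.of_apply]
      by_cases h : u = v <;> simp [h]
      congr!
    have hlr : ∀ u v, (G.join N H N').toggledMatrix (Finset.sumEquiv.symm (T, U)) (.inl u) (.inr v) =
        if N u ∧ N' v then 1 else 0 := by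
      intro u v
      refine (if_neg (by simp)).trans ?_
      by_cases h : N u ∧ N' v
      · exact (if_pos h).trans (if_pos h).symm
      · exact (if_neg h).trans (if_neg h).symm
    have hrl : ∀ u v, (G.join N H N').toggledMatrix (Finset.sumEquiv.symm (T, U)) (.inr u) (.inl v) =
        if N v ∧ N' u then 1 else 0 := by
      intro u v
      refine (if_neg (by simp)).trans ?_
      by_cases h : N v ∧ N' u
      · exact (if_pos h).trans (if_pos h).symm
      · exact (if_neg h).trans (if_neg h).symm
    let e : (G.join N H N').Kept (Finset.sumEquiv.symm (T, U)) ≃ G.Kept T ⊕ H.Kept U :=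
      Equiv.subtypeSum.trans (Equiv.sumCongr
        (Equiv.subtypeEquivRight fun v => by rw [hl]; rfl)
        (Equiv.subtypeEquivRight fun v => by rw [hr]; rfl))
    rw [← Matrix.nullity₂_submatrix _ e.symm]
    congr 1
    ext (u | u) (v | v)
    · exact hl u v
    · refine (hlr u v).trans ?_
      by_cases hu : N u <;> simp [Matrix.compose, keptIndicator, Matrix.vecMulVec, hu]
    · refine (hrl u v).trans ?_
      by_cases hv : N v <;> simp [Matrix.compose, keptIndicator, Matrix.vecMulVec, hv]
    · exact hr u v

theorem compose_eq_join (F : MarkedGraph R V) (a : V) (H : MarkedGraph R W) (b : W) :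
    F.compose a H b =
      (F.delete a).join (fun v => F.graph.Adj v a) (H.delete b) (fun w => H.graph.Adj b w) := by
  unfold compose join
  congr 2
  ext (v | w) (v' | w') <;> rfl

/-- A graph with a single vertex. -/
def single (looped marked : Prop) (x y : R) : MarkedGraph R Unit where
  graph := ⊥
  looped _ := looped
  marked _ := marked
  α _ := x
  β _ := y
  freeLoops := 0

theorem sum_finset_unit {M : Type*} [AddCommMonoid M] (f : Finset Unit → M) :
    ∑ T, f T = f ∅ + f {()} := by
  have h : (Finset.univ : Finset (Finset Unit)) = {∅, {()}} := by decide
  rw [h, Finset.sum_pair (by decide)]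

/-- All vertices survive when there are no marks. -/
def keptEquiv (G : MarkedGraph R V) (h : ∀ v, ¬ G.marked v) (T : Finset V) : G.Kept T ≃ V :=
  Equiv.subtypeUnivEquiv fun v hv => h v hv.1

theorem nullity₂_compose_single [Fintype Y] {looped : Prop} {x y : R} {T : Finset Unit}
    {P : Matrix Unit Unit (ZMod 2)}
    (hP : (single looped False x y).toggledMatrix T = P) (Q : Matrix Y Y (ZMod 2))
    (b : Y → ZMod 2) :
    (Matrix.compose ((single looped False x y).stateMatrix T)
        ((single looped False x y).keptIndicator (fun _ => True) T) Q b).nullity₂ =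
      (Matrix.compose P 1 Q b).nullity₂ := by
  rw [← Matrix.nullity₂_compose_submatrix _ 1 Q b
    (keptEquiv (single looped False x y) (fun _ h => h) T) (Equiv.refl Y), ← hP]
  congr 2
  ext
  simp [keptIndicator]

theorem bracket_join_single [CommRing R] [Fintype Y] (d x y : R) (H : MarkedGraph R Y)
    (N : Y → Prop) :
    ((single False False x y).join (fun _ => True) H N).bracket d =
      d ^ H.freeLoops * ∑ U, H.stateWeight U *
        (x * d ^ (Matrix.compose (0 : Matrix Unit Unit (ZMod 2)) 1 (H.stateMatrix U)
            (H.keptIndicator N U)).nullity₂ +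
          y * d ^ (Matrix.compose (1 : Matrix Unit Unit (ZMod 2)) 1 (H.stateMatrix U)
            (H.keptIndicator N U)).nullity₂) := by
  rw [bracket_join, sum_finset_unit, ← Finset.sum_add_distrib]
  have h0 : (single False False x y).toggledMatrix ∅ = 0 := by
    ext; simp [toggledMatrix, single]
  have h1 : (single False False x y).toggledMatrix {()} = 1 := by
    ext; simp [toggledMatrix, single]
  simp only [nullity₂_compose_single h0, nullity₂_compose_single h1]
  congr 1
  · simp [single]
  · refine Finset.sum_congr rfl fun U _ => ?_
    simp [stateWeight, single]
    ring

/-- The marked vertex drops out of the state matrix when its diagonal entry stays `0`; the state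
that toggles it has weight `0`. -/
theorem bracket_join_single_marked [CommRing R] [Fintype Y] (d z : R) (H : MarkedGraph R Y)
    (N : Y → Prop) :
    ((single False True z 0).join (fun _ => True) H N).bracket d =
      d ^ H.freeLoops * ∑ U, H.stateWeight U * (z * d ^ (H.stateMatrix U).nullity₂) := by
  rw [bracket_join, sum_finset_unit, ← Finset.sum_add_distrib]
  congr 1
  · simp [single]
  · refine Finset.sum_congr rfl fun U _ => ?_
    have : IsEmpty ((single False True z 0).Kept ∅) :=
      ⟨fun v => v.2 ⟨trivial, by simp [toggledMatrix, single]⟩⟩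
    rw [← Matrix.nullity₂_submatrix (Matrix.compose _ _ _ _) (Equiv.emptySum _ _).symm]
    have h : ((Matrix.compose ((single False True z 0).stateMatrix ∅)
        ((single False True z 0).keptIndicator (fun _ => True) ∅) (H.stateMatrix U)
        (H.keptIndicator N U)).submatrix (Equiv.emptySum _ _).symm (Equiv.emptySum _ _).symm) =
        H.stateMatrix U := rfl
    rw [h]
    simp [stateWeight, single]
    ring

/-- A vertex of a finite type and the other ones. -/
noncomputable def unitSumEquiv (b : W) : Unit ⊕ {w : W // w ≠ b} ≃ W :=
  (Equiv.sumCongr (Equiv.ofUnique Unit {w : W // w = b}) (Equiv.refl _)).trans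
    (Equiv.sumCompl fun w => w = b)

@[simp] theorem unitSumEquiv_inl (b : W) (u : Unit) : unitSumEquiv b (.inl u) = b :=
  (Equiv.ofUnique Unit {w : W // w = b} u).2

@[simp] theorem unitSumEquiv_inr (b : W) (w : {w : W // w ≠ b}) :
    unitSumEquiv b (.inr w) = w := rfl

/-- Exhibits the dependence on the weights of `b`, with `H - b` held fixed. -/
theorem bracket_reweight [CommRing R] [Fintype W] (d x y : R) (H : MarkedGraph R W) (b : W)
    (hl : ¬ H.looped b) (hm : ¬ H.marked b) :
    (H.reweight b x y).bracket d = ((single False False x y).join (fun _ => True) (H.delete b)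
      (fun w => H.graph.Adj b w)).bracket d := by
  symm
  refine bracket_congr d (unitSumEquiv b) ?_ ?_ ?_ ?_ ?_ ?_
  · rintro (u | u) (v | v) <;>
      simp [join, single, reweight, delete, H.graph.adj_comm]
  · rintro (u | u) <;> simp [join, single, reweight, delete, hl]
  · rintro (u | u) <;> simp [join, single, reweight, delete, hm]
  · rintro (u | ⟨w, hw⟩) <;> simp_all [join, single, reweight, delete]
  · rintro (u | ⟨w, hw⟩) <;> simp_all [join, single, reweight, delete]
  · simp [join, single, reweight, delete]

theorem bracket_mark_reweight [CommRing R] [Fintype W] (d x y : R) (H : MarkedGraph R W) (b : W)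
    (hl : ¬ H.looped b) :
    ((H.mark b).reweight b x y).bracket d = ((single False True x y).join (fun _ => True)
      (H.delete b) (fun w => H.graph.Adj b w)).bracket d := by
  symm
  refine bracket_congr d (unitSumEquiv b) ?_ ?_ ?_ ?_ ?_ ?_
  · rintro (u | u) (v | v) <;>
      simp [join, single, reweight, delete, mark, H.graph.adj_comm]
  · rintro (u | u) <;> simp [join, single, reweight, delete, mark, hl]
  · rintro (u | ⟨w, hw⟩) <;> simp_all [join, single, reweight, delete, mark]
  · rintro (u | ⟨w, hw⟩) <;> simp_all [join, single, reweight, delete, mark]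
  · rintro (u | ⟨w, hw⟩) <;> simp_all [join, single, reweight, delete, mark]
  · simp [join, single, reweight, delete, mark]

theorem exists_isJoinWeights [CommRing R] [Fintype V] (A B d : R) (F : MarkedGraph R V) (a : V) :
    ∃ x y z : R, F.IsJoinWeights A B d a x y z := by
  choose x y z h using fun T => Matrix.exists_coeff_pow_nullity₂_compose d
    ((F.delete a).stateMatrix_isSymm T) ((F.delete a).keptIndicator (fun v => F.graph.Adj v a) T)
  -- The weights are the bracket of `F - a` with each state's power of `d` replaced by one of its
  -- three coefficients.
  let c := fun f : Finset {v // v ≠ a} → R =>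
    d ^ F.freeLoops * ∑ T, (F.delete a).stateWeight T * f T
  refine ⟨c x, c y, c z, fun W _ H b hb _ => ?_⟩
  rw [bracket_reweight d _ _ H b hb.1 hb.2.1, bracket_mark_reweight d _ _ H b hb.1,
    bracket_join_single, bracket_join_single_marked, compose_eq_join, bracket_join, ← mul_add,
    ← Finset.sum_add_distrib, Finset.sum_comm, pow_add, mul_comm (d ^ (F.delete a).freeLoops),
    mul_assoc]
  congr 1
  rw [Finset.mul_sum]
  refine Finset.sum_congr rfl fun U _ => ?_
  have hf : (F.delete a).freeLoops = F.freeLoops := rfl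
  simp only [h, c, Finset.mul_sum, Finset.sum_mul, ← Finset.sum_add_distrib, hf]
  refine Finset.sum_congr rfl fun T _ => ?_
  ring

end MarkedGraph

/-! ### Evaluating weights on three test graphs. -/

namespace Matrix

theorem nullity₂_zero_unit : (0 : Matrix Unit Unit (ZMod 2)).nullity₂ = 1 :=
  nullity₂_eq_of_card _ _ (by rw [Nat.card_eq_fintype_card]; decide)

theorem nullity₂_one_unit : (1 : Matrix Unit Unit (ZMod 2)).nullity₂ = 0 :=
  nullity₂_eq_of_card _ _ (by rw [Nat.card_eq_fintype_card]; decide)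

theorem nullity₂_compose_unit_zero_zero :
    (compose (0 : Matrix Unit Unit (ZMod 2)) 1 (0 : Matrix Unit Unit (ZMod 2)) 1).nullity₂ = 0 :=
  nullity₂_eq_of_card _ _ (by rw [Nat.card_eq_fintype_card]; decide)

theorem nullity₂_compose_unit_zero_one :
    (compose (0 : Matrix Unit Unit (ZMod 2)) 1 (1 : Matrix Unit Unit (ZMod 2)) 1).nullity₂ = 0 :=
  nullity₂_eq_of_card _ _ (by rw [Nat.card_eq_fintype_card]; decide)

theorem nullity₂_compose_unit_one_zero :
    (compose (1 : Matrix Unit Unit (ZMod 2)) 1 (0 : Matrix Unit Unit (ZMod 2)) 1).nullity₂ = 0 :=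
  nullity₂_eq_of_card _ _ (by rw [Nat.card_eq_fintype_card]; decide)

theorem nullity₂_compose_unit_one_one :
    (compose (1 : Matrix Unit Unit (ZMod 2)) 1 (1 : Matrix Unit Unit (ZMod 2)) 1).nullity₂ = 1 :=
  nullity₂_eq_of_card _ _ (by rw [Nat.card_eq_fintype_card]; decide)

end Matrix

namespace MarkedGraph

variable {R V W X Y : Type*}

theorem nullity₂_single {looped : Prop} {x y : R} {T : Finset Unit}
    {P : Matrix Unit Unit (ZMod 2)} (hP : (single looped False x y).toggledMatrix T = P) :
    ((single looped False x y).stateMatrix T).nullity₂ = P.nullity₂ := by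
  rw [← Matrix.nullity₂_submatrix P (keptEquiv (single looped False x y) (fun _ h => h) T), ← hP]
  rfl

theorem nullity₂_compose_single_right [Fintype X] {looped : Prop} {x y : R} {T : Finset Unit}
    {Q : Matrix Unit Unit (ZMod 2)} (hQ : (single looped False x y).toggledMatrix T = Q)
    (P : Matrix X X (ZMod 2)) (a : X → ZMod 2) :
    (Matrix.compose P a ((single looped False x y).stateMatrix T)
        ((single looped False x y).keptIndicator (fun _ => True) T)).nullity₂ =
      (Matrix.compose P a Q 1).nullity₂ := by
  rw [← Matrix.nullity₂_compose_submatrix P a Q 1 (Equiv.refl X)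
    (keptEquiv (single looped False x y) (fun _ h => h) T), ← hQ]
  congr 2
  ext
  simp [keptIndicator]

theorem toggledMatrix_single_empty (marked : Prop) (x y : R) :
    (single False marked x y).toggledMatrix ∅ = 0 := by
  ext; simp [toggledMatrix, single]

theorem toggledMatrix_single_singleton (marked : Prop) (x y : R) :
    (single False marked x y).toggledMatrix {()} = 1 := by
  ext; simp [toggledMatrix, single]

theorem toggledMatrix_single_true_empty (marked : Prop) (x y : R) :
    (single True marked x y).toggledMatrix ∅ = 1 := by
  ext; simp [toggledMatrix, single]

theorem toggledMatrix_single_true_singleton (marked : Prop) (x y : R) :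
    (single True marked x y).toggledMatrix {()} = 0 := by
  ext; simp [toggledMatrix, single]; decide

theorem reweight_single (looped marked : Prop) (u v x y : R) :
    (single looped marked u v).reweight () x y = single looped marked x y := by
  simp only [reweight, single, mk.injEq, true_and, and_true]
  constructor <;> ext <;> simp

theorem mark_single (looped marked : Prop) (x y : R) :
    (single looped marked x y).mark () = single looped True x y := by
  simp [mark, single]

theorem bracket_single [CommRing R] (d x y : R) :
    (single False False x y).bracket d = x * d + y := by
  rw [bracket_eq_sum_stateWeight, sum_finset_unit,
    nullity₂_single (toggledMatrix_single_empty False x y),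
    nullity₂_single (toggledMatrix_single_singleton False x y), Matrix.nullity₂_zero_unit,
    Matrix.nullity₂_one_unit]
  simp [stateWeight, single]

theorem bracket_single_marked [CommRing R] (d z : R) :
    (single False True z 0).bracket d = z := by
  have : IsEmpty ((single False True z 0).Kept ∅) :=
    ⟨fun v => v.2 ⟨trivial, by simp [toggledMatrix, single]⟩⟩
  have h : ((single False True z 0).stateMatrix ∅).nullity₂ = 0 :=
    Module.finrank_zero_of_subsingleton
  rw [bracket_eq_sum_stateWeight, sum_finset_unit, h]
  simp [stateWeight, single]

/-- A single edge; the second vertex may be looped. -/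
def pendant (looped : Prop) (A B : R) : MarkedGraph R (Unit ⊕ Unit) :=
  (single False False A B).join (fun _ => True) (single looped False A B) (fun _ => True)

theorem reweight_join_single (marked : Prop) (u v x y : R) (H : MarkedGraph R Y) (N : Y → Prop) :
    ((single False marked u v).join (fun _ => True) H N).reweight (.inl ()) x y =
      (single False marked x y).join (fun _ => True) H N := by
  simp only [reweight, single, join, mk.injEq, true_and, and_true]
  constructor <;> ext (w | w) <;> simp

theorem mark_join_single (u v : R) (H : MarkedGraph R Y) (N : Y → Prop) :
    ((single False False u v).join (fun _ => True) H N).mark (.inl ()) =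
      (single False True u v).join (fun _ => True) H N := by
  simp only [mark, single, join, mk.injEq, true_and, and_true]
  ext (w | w) <;> simp

/-- The coefficients of `x`, `y`, `z` come from the common vertex being untouched, toggled or
deleted; in each case the far end contributes one term for each of its two states. -/
theorem bracket_reweight_pendant_false [CommRing R] (A B d x y z : R) :
    ((pendant False A B).reweight (.inl ()) x y).bracket d +
        (((pendant False A B).mark (.inl ())).reweight (.inl ()) z 0).bracket d =
      (A + B) * x + (A + B * d) * y + (A * d + B) * z := by
  rw [pendant, mark_join_single, reweight_join_single, reweight_join_single, bracket_join_single,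
    bracket_join_single_marked, sum_finset_unit, sum_finset_unit]
  simp only [nullity₂_compose_single_right (toggledMatrix_single_empty False A B),
    nullity₂_compose_single_right (toggledMatrix_single_singleton False A B),
    nullity₂_single (toggledMatrix_single_empty False A B),
    nullity₂_single (toggledMatrix_single_singleton False A B),
    Matrix.nullity₂_compose_unit_zero_zero, Matrix.nullity₂_compose_unit_zero_one,
    Matrix.nullity₂_compose_unit_one_zero, Matrix.nullity₂_compose_unit_one_one,
    Matrix.nullity₂_zero_unit, Matrix.nullity₂_one_unit]
  simp [stateWeight, single]
  ring

/-- A loop interchanges the diagonal entries in the two states of the far end, hence `A` and `B` in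
the coefficients. -/
theorem bracket_reweight_pendant_true [CommRing R] (A B d x y z : R) :
    ((pendant True A B).reweight (.inl ()) x y).bracket d +
        (((pendant True A B).mark (.inl ())).reweight (.inl ()) z 0).bracket d =
      (A + B) * x + (B + A * d) * y + (B * d + A) * z := by
  rw [pendant, mark_join_single, reweight_join_single, reweight_join_single, bracket_join_single,
    bracket_join_single_marked, sum_finset_unit, sum_finset_unit]
  simp only [nullity₂_compose_single_right (toggledMatrix_single_true_empty False A B),
    nullity₂_compose_single_right (toggledMatrix_single_true_singleton False A B),
    nullity₂_single (toggledMatrix_single_true_empty False A B),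
    nullity₂_single (toggledMatrix_single_true_singleton False A B),
    Matrix.nullity₂_compose_unit_zero_zero, Matrix.nullity₂_compose_unit_zero_one,
    Matrix.nullity₂_compose_unit_one_zero, Matrix.nullity₂_compose_unit_one_one,
    Matrix.nullity₂_zero_unit, Matrix.nullity₂_one_unit]
  simp [stateWeight, single]
  ring

theorem isStandardVertex_pendant (looped : Prop) (A B : R) :
    (pendant looped A B).IsStandardVertex A B (.inl ()) :=
  ⟨not_false, not_false, rfl, rfl⟩

variable [CommRing R] [Fintype V] {A B d x y z : R} {F : MarkedGraph R V} {a : V}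

/-- Here `H` is the common vertex alone, so that `F ∗ H` is `F - a`. -/
theorem IsJoinWeights.bracket_delete [Fintype {v // v ≠ a}] (h : F.IsJoinWeights A B d a x y z) :
    (F.delete a).bracket d = d * x + y + z := by
  have h1 := h Unit (single False False A B) () ⟨not_false, not_false, rfl, rfl⟩
    (fun _ h => absurd h not_false)
  rw [mark_single, reweight_single, reweight_single, bracket_single, bracket_single_marked] at h1
  have : IsEmpty {w : Unit // w ≠ ()} := ⟨fun w => w.2 rfl⟩
  rw [mul_comm d, ← h1]
  refine (bracket_congr (G := F.delete a) (H := F.compose a (single False False A B) ()) d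
    (Equiv.sumEmpty {v // v ≠ a} {w : Unit // w ≠ ()}).symm
    (fun _ _ => Iff.rfl) (fun _ => Iff.rfl) (fun _ => Iff.rfl) (fun _ => rfl) (fun _ => rfl)
    (Nat.add_zero _)).trans ?_
  congr!

theorem IsJoinWeights.bracket_compose_pendant_false
    [Fintype ({v // v ≠ a} ⊕ {w : Unit ⊕ Unit // w ≠ .inl ()})] (h : F.IsJoinWeights A B d a x y z) :
    (F.compose a (pendant False A B) (.inl ())).bracket d =
      (A + B) * x + (A + B * d) * y + (A * d + B) * z := by
  rw [← bracket_reweight_pendant_false, ← h _ _ _ (isStandardVertex_pendant _ A B)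
    (by rintro (_ | _) - h <;> exact h)]
  congr!

theorem IsJoinWeights.bracket_compose_pendant_true
    [Fintype ({v // v ≠ a} ⊕ {w : Unit ⊕ Unit // w ≠ .inl ()})] (h : F.IsJoinWeights A B d a x y z) :
    (F.compose a (pendant True A B) (.inl ())).bracket d =
      (A + B) * x + (B + A * d) * y + (B * d + A) * z := by
  rw [← bracket_reweight_pendant_true, ← h _ _ _ (isStandardVertex_pendant _ A B)
    (by rintro (_ | _) - h <;> exact h)]
  congr!

end MarkedGraph

/-! ### Cyclic order and first return maps of permutations. -/

section Circuits

open Equiv.Perm (SameCycle)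

variable {N K : Type*}

theorem InCyclicOrder.rotate {σ : Equiv.Perm N} {x y z w : N} (h : InCyclicOrder σ x y z w) :
    InCyclicOrder σ y z w x := by
  obtain ⟨i, j, k, hi, hij, hjk, hk, rfl, rfl, rfl⟩ := h
  have hx : x ∈ Function.periodicPts σ := Function.minimalPeriod_pos_iff_mem_periodicPts.1 (by omega)
  refine ⟨j - i, k - i, Function.minimalPeriod σ x - i, by omega, by omega, by omega, ?_, ?_, ?_, ?_⟩
  · rw [Function.minimalPeriod_apply_iterate hx]
    omega
  · rw [← Function.iterate_add_apply, Nat.sub_add_cancel (by omega)]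
  · rw [← Function.iterate_add_apply, Nat.sub_add_cancel (by omega)]
  · rw [← Function.iterate_add_apply, Nat.sub_add_cancel (by omega),
      Function.iterate_minimalPeriod]

theorem Alternate.symm {σ : Equiv.Perm N} {x x' y y' : N} (h : Alternate σ x x' y y') :
    Alternate σ y y' x x' :=
  h.elim (fun h => .inr h.rotate) (fun h => .inl h.rotate.rotate.rotate)

theorem alternate_comm {σ : Equiv.Perm N} {x x' y y' : N} :
    Alternate σ x x' y y' ↔ Alternate σ y y' x x' :=
  ⟨Alternate.symm, Alternate.symm⟩

theorem Alternate.swap_left {σ : Equiv.Perm N} {x x' y y' : N} (h : Alternate σ x x' y y') :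
    Alternate σ x' x y y' :=
  h.elim (fun h => .inr h.rotate.rotate) (fun h => .inl h.rotate.rotate)

theorem Equiv.Perm.sameCycle_iterate (σ : Equiv.Perm N) (n : ℕ) (x : N) :
    SameCycle σ x (σ^[n] x) :=
  ⟨n, by simp [Equiv.Perm.iterate_eq_pow]⟩

theorem Equiv.Perm.SameCycle.exists_iterate_eq [Finite N] {σ : Equiv.Perm N} {x y : N}
    (h : SameCycle σ x y) : ∃ n, 0 < n ∧ σ^[n] x = y := by
  obtain ⟨n, hn, -, h⟩ := h.exists_pow_eq''
  exact ⟨n, hn, by rw [Equiv.Perm.iterate_eq_pow, h]⟩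

theorem Alternate.sameCycle {σ : Equiv.Perm N} {x x' y y' : N} (h : Alternate σ x x' y y') :
    SameCycle σ x x' ∧ SameCycle σ x y := by
  rcases h with ⟨i, j, k, -, -, -, -, rfl, rfl, -⟩ | ⟨i, j, k, -, -, -, -, -, rfl, rfl⟩
  · exact ⟨σ.sameCycle_iterate _ _, σ.sameCycle_iterate _ _⟩
  · exact ⟨σ.sameCycle_iterate _ _, σ.sameCycle_iterate _ _⟩

/-- A set that an orbit leaves at one point only does not meet this orbit in two separate arcs. -/
theorem not_inCyclicOrder_of_exit_unique {σ : Equiv.Perm N} {C : Set N}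
    (hC : ∀ x ∈ C, ∀ y ∈ C, σ x ∉ C → σ y ∉ C → x = y) {x y z w : N} (hx : x ∈ C) (hy : y ∉ C)
    (hz : z ∈ C) (hw : w ∉ C) : ¬ InCyclicOrder σ x y z w := by
  rintro ⟨i, j, k, hi, hij, hjk, hk, rfl, rfl, rfl⟩
  have exit : ∀ m n, m < n → σ^[m] x ∈ C → σ^[n] x ∉ C →
      ∃ s, m ≤ s ∧ s < n ∧ σ^[s] x ∈ C ∧ σ (σ^[s] x) ∉ C := by
    intro m n hmn hm hn
    by_contra! h
    refine hn (Nat.le_induction (P := fun t _ => t ≤ n → σ^[t] x ∈ C) (fun _ => hm) ?_ n hmn.le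
      le_rfl)
    intro t hmt ht htn
    rw [Function.iterate_succ_apply']
    exact h t hmt htn (ht (by omega))
  -- The orbit leaves `C` once before time `i` and again after time `j`, within one period. These
  -- are distinct points, though `C` has only one exit.
  obtain ⟨s, -, hs, hs1, hs2⟩ := exit 0 i hi hx hy
  obtain ⟨t, ht, ht', ht1, ht2⟩ := exit j k hjk hz hw
  have := Function.iterate_injOn_Iio_minimalPeriod (f := σ) (x := x)
    (Set.mem_Iio.2 (by omega : s < _)) (Set.mem_Iio.2 (by omega : t < _)) (hC _ hs1 _ ht1 hs2 ht2)
  omega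

/-- `ρ` is the permutation that sends each element to the first element of `K` that the orbit under
`σ` meets after it, where `K` is a subset of `N` by means of `e`. -/
structure IsFirstReturn (σ : Equiv.Perm N) (ρ : Equiv.Perm K) (e : K → N) : Prop where
  injective : Function.Injective e
  exists_iterate : ∀ x, ∃ k, 0 < k ∧ σ^[k] (e x) = e (ρ x) ∧
    ∀ j, 0 < j → j < k → σ^[j] (e x) ∉ Set.range e

theorem exists_isFirstReturn [Finite N] (σ : Equiv.Perm N) {e : K → N}
    (he : Function.Injective e) : ∃ ρ : Equiv.Perm K, IsFirstReturn σ ρ e := by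
  have hex : ∀ x, ∃ k, 0 < k ∧ σ^[k] (e x) ∈ Set.range e := fun x => by
    obtain ⟨k, hk, h⟩ := (SameCycle.refl σ (e x)).exists_iterate_eq
    exact ⟨k, hk, x, h.symm⟩
  choose r hr using fun x => (Nat.find_spec (hex x)).2
  have hmin : ∀ x j, 0 < j → j < Nat.find (hex x) → σ^[j] (e x) ∉ Set.range e :=
    fun x j hj hjk h => Nat.find_min (hex x) hjk ⟨hj, h⟩
  -- If two first returns coincide, the orbit with the longer waiting time meets the other starting
  -- point on its way, against minimality.
  have hle : ∀ x y, Nat.find (hex x) ≤ Nat.find (hex y) → r x = r y → x = y := by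
    intro x y hxy h
    have h1 : σ^[Nat.find (hex y) - Nat.find (hex x)] (e y) = e x := by
      apply (σ.injective.iterate (Nat.find (hex x)))
      rw [← Function.iterate_add_apply, Nat.add_sub_cancel' hxy, ← hr, ← hr, h]
    have hx := (Nat.find_spec (hex x)).1
    rcases Nat.eq_zero_or_pos (Nat.find (hex y) - Nat.find (hex x)) with h0 | h0
    · rw [h0] at h1
      exact he h1.symm
    · exact absurd ⟨x, h1.symm⟩ (hmin y _ h0 (by omega))
  have hinj : Function.Injective r := fun x y h =>
    (le_total (Nat.find (hex x)) (Nat.find (hex y))).elim (fun h' => hle x y h' h)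
      (fun h' => (hle y x h' h.symm).symm)
  have := Finite.of_injective e he
  exact ⟨Equiv.ofBijective r (Finite.injective_iff_bijective.1 hinj), he, fun x =>
    ⟨Nat.find (hex x), (Nat.find_spec (hex x)).1, (hr x).symm, hmin x⟩⟩

namespace IsFirstReturn

variable {σ : Equiv.Perm N} {ρ : Equiv.Perm K} {e : K → N}

theorem apply_eq (h : IsFirstReturn σ ρ e) {x y : K} (hxy : σ (e x) = e y) : ρ x = y := by
  obtain ⟨k, hk, hk1, hk2⟩ := h.exists_iterate x
  rcases Nat.lt_or_ge 1 k with h1 | h1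
  · exact absurd ⟨y, hxy.symm⟩ (hk2 1 one_pos h1)
  · obtain rfl : k = 1 := by omega
    exact h.injective (hk1.symm.trans hxy)

/-- `τ n` is the time of the `n`-th visit to `K`, and every visit occurs among these. This monotone
change of time carries cycles and cyclic orders from `ρ` to `σ` and back. -/
theorem exists_times (h : IsFirstReturn σ ρ e) (x : K) : ∃ τ : ℕ → ℕ, StrictMono τ ∧ τ 0 = 0 ∧
    (∀ n, σ^[τ n] (e x) = e (ρ^[n] x)) ∧
    ∀ m y, σ^[m] (e x) = e y → ∃ n, τ n = m ∧ ρ^[n] x = y := by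
  choose k hk hk1 hk2 using h.exists_iterate
  let τ : ℕ → ℕ := fun n => ∑ i ∈ Finset.range n, k (ρ^[i] x)
  have hsucc : ∀ n, τ (n + 1) = τ n + k (ρ^[n] x) := fun n => Finset.sum_range_succ _ _
  have hmono : StrictMono τ := strictMono_nat_of_lt_succ fun n => by
    rw [hsucc]
    have := hk (ρ^[n] x)
    omega
  have hτ : ∀ n, σ^[τ n] (e x) = e (ρ^[n] x) := by
    intro n
    induction n with
    | zero => rfl
    | succ n ih =>
      rw [hsucc, add_comm, Function.iterate_add_apply, ih, hk1, Function.iterate_succ_apply']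
  have hbetween : ∀ m, ∃ n, τ n ≤ m ∧ m < τ (n + 1) := by
    intro m
    induction m with
    | zero => exact ⟨0, le_rfl, hmono one_pos⟩
    | succ m ih =>
      obtain ⟨n, hn, hn'⟩ := ih
      by_cases hm : m + 1 < τ (n + 1)
      · exact ⟨n, by omega, hm⟩
      · have := hmono (show n + 1 < n + 1 + 1 by omega)
        exact ⟨n + 1, by omega, by omega⟩
  refine ⟨τ, hmono, rfl, hτ, fun m y hm => ?_⟩
  obtain ⟨n, hn, hn'⟩ := hbetween m
  have heq : τ n = m := by
    by_contra hne
    refine hk2 (ρ^[n] x) (m - τ n) (by omega) (by rw [hsucc] at hn'; omega) ⟨y, ?_⟩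
    rw [← hτ, ← Function.iterate_add_apply, Nat.sub_add_cancel hn, hm]
  exact ⟨n, heq, h.injective (by rw [← hτ, heq, hm])⟩

theorem sameCycle_iff [Finite N] (h : IsFirstReturn σ ρ e) {x y : K} :
    SameCycle ρ x y ↔ SameCycle σ (e x) (e y) := by
  have := Finite.of_injective e h.injective
  obtain ⟨τ, -, -, hτ, hτ'⟩ := h.exists_times x
  constructor
  · intro hxy
    obtain ⟨n, -, rfl⟩ := hxy.exists_iterate_eq
    rw [← hτ]
    exact σ.sameCycle_iterate _ _
  · intro hxy
    obtain ⟨m, -, hm⟩ := hxy.exists_iterate_eq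
    obtain ⟨n, -, rfl⟩ := hτ' m y hm
    exact ρ.sameCycle_iterate _ _

theorem inCyclicOrder_iff [Finite N] (h : IsFirstReturn σ ρ e) {x y z w : K} :
    InCyclicOrder ρ x y z w ↔ InCyclicOrder σ (e x) (e y) (e z) (e w) := by
  have := Finite.of_injective e h.injective
  obtain ⟨τ, hmono, h0, hτ, hτ'⟩ := h.exists_times x
  have hpos : 0 < Function.minimalPeriod ρ x := by
    obtain ⟨n, hn, hx⟩ := (SameCycle.refl ρ x).exists_iterate_eq
    exact Function.IsPeriodicPt.minimalPeriod_pos hn hx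
  have hper : Function.minimalPeriod σ (e x) = τ (Function.minimalPeriod ρ x) := by
    have h1 : Function.IsPeriodicPt σ (τ (Function.minimalPeriod ρ x)) (e x) := by
      rw [Function.IsPeriodicPt, Function.IsFixedPt, hτ, Function.iterate_minimalPeriod]
    have h2 : 0 < τ (Function.minimalPeriod ρ x) := h0 ▸ hmono hpos
    refine le_antisymm (h1.minimalPeriod_le h2) ?_
    obtain ⟨n, hn, hn'⟩ := hτ' _ x (Function.iterate_minimalPeriod (f := σ) (x := e x))
    have hn0 : 0 < n := by
      have := h1.minimalPeriod_pos h2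
      rw [← hn, ← h0] at this
      exact hmono.lt_iff_lt.1 this
    rw [← hn]
    exact hmono.monotone (Function.IsPeriodicPt.minimalPeriod_le hn0 hn')
  constructor
  · rintro ⟨i, j, k, hi, hij, hjk, hk, rfl, rfl, rfl⟩
    exact ⟨τ i, τ j, τ k, h0 ▸ hmono hi, hmono hij, hmono hjk, hper ▸ hmono hk, hτ _, hτ _, hτ _⟩
  · rintro ⟨i, j, k, hi, hij, hjk, hk, hy, hz, hw⟩
    obtain ⟨i, rfl, rfl⟩ := hτ' _ _ hy
    obtain ⟨j, rfl, rfl⟩ := hτ' _ _ hz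
    obtain ⟨k, rfl, rfl⟩ := hτ' _ _ hw
    rw [hper] at hk
    rw [← h0] at hi
    exact ⟨i, j, k, hmono.lt_iff_lt.1 hi, hmono.lt_iff_lt.1 hij, hmono.lt_iff_lt.1 hjk,
      hmono.lt_iff_lt.1 hk, rfl, rfl, rfl⟩

theorem alternate_iff [Finite N] (h : IsFirstReturn σ ρ e) {x y z w : K} :
    Alternate ρ x y z w ↔ Alternate σ (e x) (e y) (e z) (e w) :=
  or_congr h.inCyclicOrder_iff h.inCyclicOrder_iff

end IsFirstReturn

theorem Equiv.Perm.eq_of_forall_ne {f g : Equiv.Perm N} (c : N) (h : ∀ x, x ≠ c → f x = g x) :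
    f = g := by
  have hc : f c = g c := by
    obtain ⟨x, hx⟩ := f.surjective (g c)
    by_cases hxc : x = c
    · rw [← hx, hxc]
    · rw [h x hxc] at hx
      exact absurd (g.injective hx) hxc
  ext x
  by_cases hxc : x = c
  · rw [hxc, hc]
  · exact h x hxc

/-! ### Multiplication by a transposition: merging and splitting cycles. -/

section Swap

variable [DecidableEq K] {ρ ρ' : Equiv.Perm K} {a b : K}

theorem eq_mul_swap_symm (h : ρ' = ρ * Equiv.swap a b) : ρ = ρ' * Equiv.swap a b := by
  rw [h, mul_assoc, Equiv.swap_mul_self, mul_one]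

theorem apply_eq_of_mul_swap (h : ρ' = ρ * Equiv.swap a b) {x : K} (ha : x ≠ a) (hb : x ≠ b) :
    ρ' x = ρ x := by
  rw [h, Equiv.Perm.mul_apply, Equiv.swap_apply_of_ne_of_ne ha hb]

/-- Since `ρ' b = ρ a`, the two orbits run together until they reach `a` or `b`. -/
theorem iterate_right_eq_of_mul_swap (h : ρ' = ρ * Equiv.swap a b) (n : ℕ)
    (hn : ∀ j, 0 < j → j < n → ρ^[j] a ≠ a ∧ ρ^[j] a ≠ b) :
    ∀ j, 0 < j → j ≤ n → ρ'^[j] b = ρ^[j] a := by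
  intro j hj hjn
  induction j with
  | zero => omega
  | succ j ih =>
    rcases Nat.eq_zero_or_pos j with rfl | hj0
    · simp [h]
    · rw [Function.iterate_succ_apply', Function.iterate_succ_apply', ih hj0 (by omega)]
      exact apply_eq_of_mul_swap h (hn j hj0 (by omega)).1 (hn j hj0 (by omega)).2

theorem sameCycle_mul_swap_of_not [Finite K] (h : ρ' = ρ * Equiv.swap a b)
    (hab : ¬ SameCycle ρ a b) : SameCycle ρ' a b := by
  have hex := (SameCycle.refl ρ a).exists_iterate_eq
  have hn := Nat.find_spec hex
  have := iterate_right_eq_of_mul_swap h (Nat.find hex) (fun j hj hjn =>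
    ⟨fun hja => Nat.find_min hex hjn ⟨hj, hja⟩, fun hjb => hab (hjb ▸ ρ.sameCycle_iterate j a)⟩)
    _ hn.1 le_rfl
  rw [hn.2] at this
  exact (this ▸ ρ'.sameCycle_iterate _ b).symm

/-- From `b`, `ρ'` runs along the `ρ`-arc from `a` to `b` and closes up there without meeting `a`.
-/
theorem not_sameCycle_mul_swap [Finite K] (h : ρ' = ρ * Equiv.swap a b) (hne : a ≠ b)
    (hab : SameCycle ρ a b) : ¬ SameCycle ρ' a b := by
  have hex := hab.exists_iterate_eq
  obtain ⟨hn, hnb⟩ := Nat.find_spec hex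
  have hmin : ∀ j, 0 < j → j < Nat.find hex → ρ^[j] a ≠ a ∧ ρ^[j] a ≠ b := by
    refine fun j hj hjn => ⟨fun hja => ?_, fun hjb => Nat.find_min hex hjn ⟨hj, hjb⟩⟩
    refine Nat.find_min hex (m := Nat.find hex - j) (by omega) ⟨by omega, ?_⟩
    have := Function.iterate_add_apply ρ (Nat.find hex - j) j a
    rwa [Nat.sub_add_cancel hjn.le, hnb, hja, eq_comm] at this
  have hit := iterate_right_eq_of_mul_swap h (Nat.find hex) hmin
  have hper : Function.IsPeriodicPt ρ' (Nat.find hex) b := (hit _ hn le_rfl).trans hnb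
  intro hba
  obtain ⟨m, -, hm⟩ := hba.symm.exists_iterate_eq
  rw [← hper.iterate_mod_apply] at hm
  rcases Nat.eq_zero_or_pos (m % Nat.find hex) with h0 | h0
  · rw [h0] at hm
    exact hne hm.symm
  · have hlt := Nat.mod_lt m hn
    rw [hit _ h0 hlt.le] at hm
    exact (hmin _ h0 hlt).1 hm

/-- Each step of `ρ` is a step of `ρ'` up to exchanging `a` and `b`, which lie on one cycle of `ρ'`.
-/
theorem sameCycle_mul_swap_of_sameCycle [Finite K] (h : ρ' = ρ * Equiv.swap a b)
    (hab : SameCycle ρ' a b) {x y : K} (hxy : SameCycle ρ x y) : SameCycle ρ' x y := by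
  have step : ∀ x, SameCycle ρ' x (ρ x) := by
    intro x
    by_cases hxa : x = a
    · have : ρ' b = ρ x := by simp [h, hxa]
      rw [← this, Equiv.Perm.sameCycle_apply_right, hxa]
      exact hab
    by_cases hxb : x = b
    · have : ρ' a = ρ x := by simp [h, hxb]
      rw [← this, Equiv.Perm.sameCycle_apply_right, hxb]
      exact hab.symm
    rw [← apply_eq_of_mul_swap h hxa hxb, Equiv.Perm.sameCycle_apply_right]
  obtain ⟨n, -, rfl⟩ := hxy.exists_iterate_eq
  induction n with
  | zero => exact SameCycle.refl _ _
  | succ n ih =>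
    rw [Function.iterate_succ_apply']
    exact (ih (ρ.sameCycle_iterate _ _)).trans (step _)

theorem sameCycle_mul_swap_iff_of_not [Finite K] (h : ρ' = ρ * Equiv.swap a b) {x : K}
    (ha : ¬ SameCycle ρ x a) (hb : ¬ SameCycle ρ x b) (y : K) :
    SameCycle ρ' x y ↔ SameCycle ρ x y := by
  have hit : ∀ n, ρ'^[n] x = ρ^[n] x := by
    intro n
    induction n with
    | zero => rfl
    | succ n ih =>
      rw [Function.iterate_succ_apply', Function.iterate_succ_apply', ih]
      exact apply_eq_of_mul_swap h (fun hn => ha (hn ▸ ρ.sameCycle_iterate n x))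
        (fun hn => hb (hn ▸ ρ.sameCycle_iterate n x))
  constructor <;> intro hxy <;> obtain ⟨n, -, rfl⟩ := hxy.exists_iterate_eq
  · exact hit n ▸ ρ.sameCycle_iterate n x
  · exact hit n ▸ ρ'.sameCycle_iterate n x

/-- The `ρ`-cycle of `v` contains at most one of `a`, `b`. With these points removed, it is a set
that `ρ'` leaves at one point at most, so `not_inCyclicOrder_of_exit_unique` applies. -/
theorem not_alternate_mul_swap (h : ρ' = ρ * Equiv.swap a b) (hab : ¬ SameCycle ρ a b)
    {v v' w w' : K} (hv : SameCycle ρ v v') (hva : v ≠ a) (hvb : v ≠ b) (hva' : v' ≠ a)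
    (hvb' : v' ≠ b) (hw : SameCycle ρ v w → w = a ∨ w = b)
    (hw' : SameCycle ρ v w' → w' = a ∨ w' = b) : ¬ Alternate ρ' v v' w w' := by
  let C : Set K := {x | SameCycle ρ v x ∧ x ≠ a ∧ x ≠ b}
  have hC : ∀ x ∈ C, ∀ y ∈ C, ρ' x ∉ C → ρ' y ∉ C → x = y := by
    rintro x ⟨hx, hxa, hxb⟩ y ⟨hy, hya, hyb⟩ hx' hy'
    rw [apply_eq_of_mul_swap h hxa hxb] at hx'
    rw [apply_eq_of_mul_swap h hya hyb] at hy'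
    have h1 : SameCycle ρ v (ρ x) := Equiv.Perm.sameCycle_apply_right.2 hx
    have h2 : SameCycle ρ v (ρ y) := Equiv.Perm.sameCycle_apply_right.2 hy
    have h3 : ρ x = a ∨ ρ x = b := by
      by_contra! hn
      exact hx' ⟨h1, hn⟩
    have h4 : ρ y = a ∨ ρ y = b := by
      by_contra! hn
      exact hy' ⟨h2, hn⟩
    have h5 := h1.symm.trans h2
    apply ρ.injective
    rcases h3 with h3 | h3 <;> rcases h4 with h4 | h4 <;> rw [h3, h4] at h5 ⊢
    · exact absurd h5 hab
    · exact absurd h5.symm hab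
  have hvC : v ∈ C := ⟨SameCycle.refl _ _, hva, hvb⟩
  have hvC' : v' ∈ C := ⟨hv, hva', hvb'⟩
  have hwC : w ∉ C := fun hn => (hw hn.1).elim hn.2.1 hn.2.2
  have hwC' : w' ∉ C := fun hn => (hw' hn.1).elim hn.2.1 hn.2.2
  rintro (h | h)
  · exact not_inCyclicOrder_of_exit_unique hC hvC hwC hvC' hwC' h
  · exact not_inCyclicOrder_of_exit_unique hC hvC hwC' hvC' hwC h

/-- On the `ρ`-cycle of `v`, the first return of `ρ'` agrees with `ρ` except possibly at one point,
hence everywhere, and the cyclic order there survives the merging. Pairs on different `ρ`-cycles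
alternate neither before nor after. -/
theorem alternate_mul_swap_iff [Finite K] (h : ρ' = ρ * Equiv.swap a b) (hab : ¬ SameCycle ρ a b)
    {v v' w w' : K} (hv : SameCycle ρ v v') (hva : v ≠ a) (hvb : v ≠ b) (hva' : v' ≠ a)
    (hvb' : v' ≠ b) (hw : SameCycle ρ w w') : Alternate ρ' v v' w w' ↔ Alternate ρ v v' w w' := by
  by_cases hvw : SameCycle ρ v w
  · let C : K → Prop := fun x => SameCycle ρ v x
    have hCρ : ∀ x, C (ρ x) ↔ C x := fun x => Equiv.Perm.sameCycle_apply_right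
    let ρC : Equiv.Perm {x // C x} := ρ.subtypePerm hCρ
    have h1 : IsFirstReturn ρ ρC Subtype.val :=
      ⟨Subtype.val_injective, fun x => ⟨1, one_pos, rfl, fun j hj hj1 => by omega⟩⟩
    obtain ⟨ρ'', h2⟩ := exists_isFirstReturn ρ' (e := (Subtype.val : {x // C x} → K))
      Subtype.val_injective
    have h3 : ∀ x : {x // C x}, x.1 ≠ a → x.1 ≠ b → ρ'' x = ρC x := fun x hxa hxb =>
      h2.apply_eq (apply_eq_of_mul_swap h hxa hxb)
    have h4 : ρ'' = ρC := by
      by_cases ha : C a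
      · refine Equiv.Perm.eq_of_forall_ne ⟨a, ha⟩ fun x hx => h3 x (fun hn => hx (Subtype.ext hn))
          fun hn => hab (ha.symm.trans (hn ▸ x.2))
      · by_cases hb : C b
        · exact Equiv.Perm.eq_of_forall_ne ⟨b, hb⟩ fun x hx => h3 x (fun hn => ha (hn ▸ x.2))
            (fun hn => hx (Subtype.ext hn))
        · exact Equiv.ext fun x => h3 x (fun hn => ha (hn ▸ x.2)) fun hn => hb (hn ▸ x.2)
    subst h4
    exact (h2.alternate_iff (x := ⟨v, SameCycle.refl _ _⟩) (y := ⟨v', hv⟩) (z := ⟨w, hvw⟩)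
      (w := ⟨w', hvw.trans hw⟩)).symm.trans h1.alternate_iff
  · exact iff_of_false (not_alternate_mul_swap h hab hv hva hvb hva' hvb' (fun hn => absurd hn hvw)
      (fun hn => absurd (hn.trans hw.symm) hvw)) fun hn => hvw hn.sameCycle.2

end Swap

/-- The cycles of `ρ` that avoid `A`. -/
def cyclesAvoiding (ρ : Equiv.Perm K) (A : Set K) : Set (Set K) :=
  {C | ∃ x, C = {y | SameCycle ρ x y} ∧ ∀ a ∈ A, ¬ SameCycle ρ x a}

theorem cyclesAvoiding_mul_swap [Finite K] [DecidableEq K] {ρ ρ' : Equiv.Perm K} {a b : K} {A : Set K}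
    (h : ρ' = ρ * Equiv.swap a b) (ha : a ∈ A) (hb : b ∈ A) :
    cyclesAvoiding ρ' A = cyclesAvoiding ρ A := by
  have key : ∀ {ρ ρ' : Equiv.Perm K}, ρ' = ρ * Equiv.swap a b →
      cyclesAvoiding ρ A ⊆ cyclesAvoiding ρ' A := by
    rintro ρ ρ' h C ⟨x, rfl, hx⟩
    have hiff := sameCycle_mul_swap_iff_of_not h (hx a ha) (hx b hb)
    exact ⟨x, by simp [hiff], by simpa [hiff] using hx⟩
  exact (key (eq_mul_swap_symm h)).antisymm (key h)

/-! ### Euler systems and components of the universe. -/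

namespace LinkDiagram

variable {V P K : Type*} {D : LinkDiagram V P} {M : V → Bool}

theorem component_next (D : LinkDiagram V P) (x : V × Bool ⊕ P) :
    D.component (D.next x) = D.component x :=
  (Quot.sound (Linked.arc x)).symm

theorem component_crossing (D : LinkDiagram V P) (v : V) (s : Bool) :
    D.component (.inl (v, s)) = D.component (.inl (v, false)) := by
  cases s
  · rfl
  · exact (Quot.sound (Linked.crossing v)).symm

theorem component_circuits (D : LinkDiagram V P) (M : V → Bool) (x : V × Bool ⊕ P) :
    D.component (D.circuits M x) = D.component x := by
  refine (D.component_next _).trans ?_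
  rcases x with ⟨v, s⟩ | p
  · exact (D.component_crossing v _).trans (D.component_crossing v s).symm
  · rfl

theorem component_eq_of_sameCycle [Finite V] [Finite P] {x y : V × Bool ⊕ P}
    (h : SameCycle (D.circuits M) x y) : D.component x = D.component y := by
  obtain ⟨n, -, rfl⟩ := h.exists_iterate_eq
  induction n with
  | zero => rfl
  | succ n ih =>
    rw [Function.iterate_succ_apply', component_circuits]
    exact ih ((D.circuits M).sameCycle_iterate _ _)

/-- Circuits never leave a component. Conversely, the circuit that uses the arc out of a node
arrives through the same node or the other passage of its crossing, so only the two passages of each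
crossing have to share a circuit. -/
theorem isEulerSystem_iff [Finite V] [Finite P] : D.IsEulerSystem M ↔
    ∀ v, SameCycle (D.circuits M) (.inl (v, false)) (.inl (v, true)) := by
  refine ⟨fun h v => (h _ _).1 (D.component_crossing v true).symm, fun h x y =>
    ⟨fun hxy => ?_, component_eq_of_sameCycle⟩⟩
  have hs : ∀ z, SameCycle (D.circuits M) z (D.next z) := by
    intro z
    have h1 : D.circuits M ((switch M).symm z) = D.next z := by
      simp [circuits]
    rw [← h1, Equiv.Perm.sameCycle_apply_right]
    rcases z with ⟨v, s⟩ | p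
    · have h2 : (switch M).symm (.inl (v, s) : V × Bool ⊕ P) = .inl (v, xor s (M v)) := rfl
      rw [h2]
      cases s <;> cases M v
      · exact SameCycle.refl _ _
      · exact h v
      · exact SameCycle.refl _ _
      · exact (h v).symm
    · exact SameCycle.refl _ _
  have hrel : ∀ x y, D.Linked x y → SameCycle (D.circuits M) x y := by
    intro x y hxy
    cases hxy with
    | arc => exact hs x
    | crossing v => exact h v
  have := Quot.eqvGen_exact hxy
  clear hxy
  induction this with
  | rel x y hxy => exact hrel x y hxy
  | refl x => exact SameCycle.refl _ _
  | symm x y _ ih => exact ih.symm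
  | trans x y z _ _ ih1 ih2 => exact ih1.trans ih2

/-- An Euler system has one circuit per component, so components can be counted as cycles of any
first return map. -/
theorem ncard_component_avoiding [Finite V] [Finite P] (hD : D.IsEulerSystem M)
    {ρ : Equiv.Perm K} {e : K → V × Bool ⊕ P} (h : IsFirstReturn (D.circuits M) ρ e) (A : Set K) :
    {c | (∃ x, D.component (e x) = c) ∧ ∀ a ∈ A, D.component (e a) ≠ c}.ncard =
      (cyclesAvoiding ρ A).ncard := by
  have hiff : ∀ x y, D.component (e x) = D.component (e y) ↔ SameCycle ρ x y := fun x y =>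
    (hD _ _).trans h.sameCycle_iff.symm
  let Φ : D.Component → Set K := fun c => {y | D.component (e y) = c}
  have himage : Φ '' {c | (∃ x, D.component (e x) = c) ∧ ∀ a ∈ A, D.component (e a) ≠ c} =
      cyclesAvoiding ρ A := by
    ext C
    constructor
    · rintro ⟨_, ⟨⟨x, rfl⟩, hx⟩, rfl⟩
      refine ⟨x, ?_, fun a ha hxa => hx a ha ((hiff _ _).2 hxa.symm)⟩
      ext y
      simp only [Φ, Set.mem_ofPred_eq, hiff]
      exact ⟨SameCycle.symm, SameCycle.symm⟩
    · rintro ⟨x, rfl, hx⟩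
      refine ⟨D.component (e x), ⟨⟨x, rfl⟩, fun a ha hxa => hx a ha ((hiff _ _).1 hxa).symm⟩, ?_⟩
      ext y
      simp only [Φ, Set.mem_ofPred_eq, hiff]
      exact ⟨SameCycle.symm, SameCycle.symm⟩
  rw [← himage]
  refine (Set.InjOn.ncard_image ?_).symm
  rintro _ ⟨⟨x, rfl⟩, -⟩ _ ⟨⟨y, rfl⟩, -⟩ hxy
  have : x ∈ Φ (D.component (e y)) := by
    rw [← hxy]
    rfl
  exact this

end LinkDiagram

/-! ### Replacing the inside of the circle by one crossing. -/

namespace Tangle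

variable {R V W : Type*} {T : Tangle V} {S : Tangle W} {M : V ⊕ W → Bool}

/-- The ends of the arcs of `T`, as nodes of a diagram in which `T` lies outside a circle. -/
def outsideNode (x : V × Bool ⊕ Bool) : (V ⊕ W) × Bool ⊕ (Bool ⊕ Bool) :=
  endEquiv.symm (.inl x)

/-- The crossings of `T` and the crossing that closes it, as nodes of the closed diagram; the
strand of the latter that comes in at `i` stands for the point `i` of the circle. -/
def closedNode (f : Equiv.Perm Bool) : V × Bool ⊕ Bool → (V ⊕ Unit) × Bool ⊕ (Bool ⊕ Bool)
  | .inl (v, s) => .inl (.inl v, s)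
  | .inr i => .inl (.inr (), f i)

theorem outsideNode_injective : Function.Injective (outsideNode : V × Bool ⊕ Bool →
    (V ⊕ W) × Bool ⊕ (Bool ⊕ Bool)) :=
  endEquiv.symm.injective.comp Sum.inl_injective

theorem closedNode_injective (f : Equiv.Perm Bool) :
    Function.Injective (closedNode f : V × Bool ⊕ Bool → _) := by
  rintro (⟨v, s⟩ | i) (⟨w, t⟩ | j) h <;> simp_all [closedNode]

/-- How the circuits run outside the circle when, inside it, the entry `i` is connected to the exit
`ρ i`: from the end of an arc to the end of the next one. -/
def returnPerm (T : Tangle V) (m : V → Bool) (ρ : Equiv.Perm Bool) :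
    Equiv.Perm (V × Bool ⊕ Bool) :=
  ((LinkDiagram.switch m).trans (Equiv.sumCongr (Equiv.refl _) ρ)).trans T.arc

theorem returnPerm_mul_swap (T : Tangle V) (m : V → Bool) (ρ : Equiv.Perm Bool) :
    T.returnPerm m (ρ * Equiv.swap false true) =
      T.returnPerm m ρ * Equiv.swap (.inr false) (.inr true) := by
  ext1 x
  rw [Equiv.Perm.mul_apply]
  rcases x with ⟨v, s⟩ | (_ | _)
  · rw [Equiv.swap_apply_of_ne_of_ne (by simp) (by simp)]
    rfl
  · rw [Equiv.swap_apply_left]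
    rfl
  · rw [Equiv.swap_apply_right]
    rfl

/-- At crossings of `T` the first return does not depend on the inside. It differs from `returnPerm`
with trivial inside by a permutation fixing all these passages, that is, by a permutation of the two
entry points. -/
theorem exists_isFirstReturn_returnPerm [Finite V] [Finite W] (T : Tangle V) (S : Tangle W)
    (M : V ⊕ W → Bool) : ∃ ρ, IsFirstReturn ((T.glue S).circuits M)
      (T.returnPerm (fun v => M (.inl v)) ρ) outsideNode := by
  obtain ⟨τ, hτ⟩ := exists_isFirstReturn ((T.glue S).circuits M)
    (outsideNode_injective (V := V) (W := W))
  have h1 : ∀ x : V × Bool, τ (.inl x) = T.returnPerm (fun v => M (.inl v)) 1 (.inl x) :=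
    fun x => hτ.apply_eq rfl
  let q : Equiv.Perm (V × Bool ⊕ Bool) := (T.returnPerm (fun v => M (.inl v)) 1)⁻¹ * τ
  have hq : ∀ x, q (.inl x) = .inl x := fun x => by simp [q, h1]
  obtain ⟨⟨q₁, ρ⟩, hq'⟩ := Equiv.Perm.mem_sumCongrHom_range_of_perm_mapsTo_inl (σ := q) (by
    rintro _ ⟨x, rfl⟩
    exact ⟨x, (hq x).symm⟩)
  refine ⟨ρ, ?_⟩
  convert hτ using 1
  have hqτ : τ = T.returnPerm (fun v => M (.inl v)) 1 * q := by simp [q]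
  ext1 x
  rw [hqτ, Equiv.Perm.mul_apply]
  rcases x with x | i
  · rw [hq]
    rfl
  · rw [← hq']
    rfl

/-- The return takes one to three steps, according to the points of the circle passed on the way.
Passages of the new crossing replace points of the circle because interlacement refers to them. -/
theorem isFirstReturn_closedNode (T : Tangle V) (M : V ⊕ W → Bool) (isNegative : Prop)
    (f g : Equiv.Perm Bool) : IsFirstReturn ((T.closure isNegative f g).circuits (closedMarks M))
      (T.returnPerm (fun v => M (.inl v)) (f.trans g)) (closedNode f) := by
  refine ⟨closedNode_injective f, ?_⟩
  set c := (T.closure isNegative f g).circuits (closedMarks M) with hc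
  have hv : ∀ v s, c (.inl (.inl v, s)) =
      outsideNode (T.arc (.inl (v, xor s (M (.inl v))))) := fun v s => rfl
  have hn : ∀ s, c (.inl (.inr (), s)) = .inr (.inr (g s)) := by
    rintro (_ | _) <;> rfl
  have ho : ∀ o, c (.inr (.inr o)) = outsideNode (T.arc (.inr o)) := fun o => rfl
  have hi : ∀ i, c (.inr (.inl i)) = .inl (.inr (), f i) := fun i => rfl
  have hnotMem : ∀ p, (.inr p : (V ⊕ Unit) × Bool ⊕ (Bool ⊕ Bool)) ∉
      Set.range (closedNode f) := by
    rintro p ⟨⟨v, s⟩ | i, h⟩ <;> simp [closedNode] at h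
  have hout : ∀ y : V × Bool ⊕ Bool, (∃ x, y = .inl x ∧ outsideNode y = closedNode f y) ∨
      (∃ i, y = .inr i ∧ outsideNode (W := Unit) y = .inr (.inl i)) := by
    rintro (x | i)
    · exact .inl ⟨x, rfl, rfl⟩
    · exact .inr ⟨i, rfl, rfl⟩
  rintro (⟨v, s⟩ | i)
  · have hR : T.returnPerm (fun v => M (.inl v)) (f.trans g) (.inl (v, s)) =
        T.arc (.inl (v, xor s (M (.inl v)))) := rfl
    rw [hR]
    rcases hout (T.arc (.inl (v, xor s (M (.inl v))))) with ⟨x, -, h⟩ | ⟨i, hyi, h⟩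
    · exact ⟨1, one_pos, (hv v s).trans h, fun j hj hj1 => by omega⟩
    · refine ⟨2, two_pos, ?_, fun j hj hj2 => ?_⟩
      · rw [hyi]
        exact (congrArg c ((hv v s).trans h)).trans (hi i)
      · obtain rfl : j = 1 := by omega
        have h1 : c^[1] (closedNode f (.inl (v, s))) = .inr (.inl i) := (hv v s).trans h
        rw [h1]
        exact hnotMem _
  · have hR : T.returnPerm (fun v => M (.inl v)) (f.trans g) (.inr i) =
        T.arc (.inr (g (f i))) := rfl
    have h1 : c^[1] (closedNode f (.inr i)) = .inr (.inr (g (f i))) := hn (f i)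
    have h2 : c^[2] (closedNode f (.inr i)) = outsideNode (T.arc (.inr (g (f i)))) :=
      (congrArg c h1).trans (ho _)
    rw [hR]
    rcases hout (T.arc (.inr (g (f i)))) with ⟨x, -, h⟩ | ⟨i', hyi, h⟩
    · refine ⟨2, two_pos, h2.trans h, fun j hj hj2 => ?_⟩
      obtain rfl : j = 1 := by omega
      rw [h1]
      exact hnotMem _
    · refine ⟨3, three_pos, ?_, fun j hj hj3 => ?_⟩
      · rw [hyi]
        exact (congrArg c (h2.trans h)).trans (hi i')
      · obtain rfl | rfl : j = 1 ∨ j = 2 := by omega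
        · rw [h1]
          exact hnotMem _
        · rw [h2, h]
          exact hnotMem _

theorem sameCycle_inr_comm {ρ : Equiv.Perm (V × Bool ⊕ Bool)} (f : Equiv.Perm Bool) :
    SameCycle ρ (.inr (f false)) (.inr (f true)) ↔ SameCycle ρ (.inr false) (.inr true) := by
  rcases (by decide : ∀ f : Equiv.Perm Bool, (f false = false ∧ f true = true) ∨
    (f false = true ∧ f true = false)) f with ⟨h0, h1⟩ | ⟨h0, h1⟩ <;> rw [h0, h1]
  exact ⟨SameCycle.symm, SameCycle.symm⟩

theorem alternate_inr_comm {ρ : Equiv.Perm (V × Bool ⊕ Bool)} (f : Equiv.Perm Bool)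
    {y y' : V × Bool ⊕ Bool} : Alternate ρ (.inr (f false)) (.inr (f true)) y y' ↔
      Alternate ρ (.inr false) (.inr true) y y' := by
  rcases (by decide : ∀ f : Equiv.Perm Bool, (f false = false ∧ f true = true) ∨
    (f false = true ∧ f true = false)) f with ⟨h0, h1⟩ | ⟨h0, h1⟩ <;> rw [h0, h1]
  exact ⟨Alternate.swap_left, Alternate.swap_left⟩

theorem closedNode_inr_symm (f : Equiv.Perm Bool) (s : Bool) :
    (closedNode f (.inr (f.symm s)) : (V ⊕ Unit) × Bool ⊕ (Bool ⊕ Bool)) =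
      .inl (.inr (), s) := by
  simp [closedNode]

theorem isCompatible_iff [Finite V] {isNegative : Prop} {f g : Equiv.Perm Bool} :
    T.IsCompatible M isNegative f g ↔
      (∀ v, SameCycle (T.returnPerm (fun v => M (.inl v)) (f.trans g)) (.inl (v, false))
        (.inl (v, true))) ∧
      SameCycle (T.returnPerm (fun v => M (.inl v)) (f.trans g)) (.inr false) (.inr true) := by
  have h := T.isFirstReturn_closedNode M isNegative f g
  rw [IsCompatible, LinkDiagram.isEulerSystem_iff, Sum.forall, ← sameCycle_inr_comm f.symm,
    h.sameCycle_iff, closedNode_inr_symm, closedNode_inr_symm]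
  simp only [h.sameCycle_iff]
  exact and_congr Iff.rfl ⟨fun h => h (), fun h _ => h⟩

/-- The two ways to connect the points of the circle differ by a transposition. -/
theorem returnPerm_eq_or (T : Tangle V) (m : V → Bool) (σ τ : Equiv.Perm Bool) :
    T.returnPerm m τ = T.returnPerm m σ ∨
      T.returnPerm m τ = T.returnPerm m σ * Equiv.swap (.inr false) (.inr true) := by
  rcases (by decide : ∀ σ τ : Equiv.Perm Bool, τ = σ ∨ τ = σ * Equiv.swap false true) σ τ with
    rfl | rfl
  · exact .inl rfl
  · exact .inr (returnPerm_mul_swap _ _ _)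

/-- The connection made by `S` serves if both entry points lie on one circuit; otherwise the other
connection merges their circuits and keeps every crossing on a single one. -/
theorem exists_isCompatible [Finite V] [Finite W] (hM : (T.glue S).IsEulerSystem M)
    (isNegative : Prop) : ∃ f g : Equiv.Perm Bool, T.IsCompatible M isNegative f g := by
  obtain ⟨σ, hσ⟩ := exists_isFirstReturn_returnPerm T S M
  have hv : ∀ v, SameCycle (T.returnPerm (fun v => M (.inl v)) σ) (.inl (v, false))
      (.inl (v, true)) := fun v => hσ.sameCycle_iff.2 (LinkDiagram.isEulerSystem_iff.1 hM (.inl v))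
  by_cases h : SameCycle (T.returnPerm (fun v => M (.inl v)) σ) (.inr false) (.inr true)
  · exact ⟨Equiv.refl _, σ, isCompatible_iff.2 ⟨hv, h⟩⟩
  · have hswap := returnPerm_mul_swap T (fun v => M (.inl v)) σ
    have h' := sameCycle_mul_swap_of_not hswap h
    exact ⟨Equiv.refl _, σ * Equiv.swap false true, isCompatible_iff.2
      ⟨fun v => sameCycle_mul_swap_of_sameCycle hswap h' (hv v), h'⟩⟩

section Closed

variable [Finite V] {isNegative : Prop} {f g : Equiv.Perm Bool}

/-- Compatibility puts both entry points on one circuit, and undoing a transposition splits it.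
Hence a change of connection means that the original circuits through them were different. -/
theorem returnPerm_eq_or_of_isCompatible (hf : T.IsCompatible M isNegative f g)
    (σ : Equiv.Perm Bool) :
    T.returnPerm (fun v => M (.inl v)) (f.trans g) = T.returnPerm (fun v => M (.inl v)) σ ∨
      T.returnPerm (fun v => M (.inl v)) (f.trans g) =
        T.returnPerm (fun v => M (.inl v)) σ * Equiv.swap (.inr false) (.inr true) ∧
      ¬ SameCycle (T.returnPerm (fun v => M (.inl v)) σ) (.inr false) (.inr true) :=
  (returnPerm_eq_or T _ σ (f.trans g)).imp_right fun h =>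
    ⟨h, not_sameCycle_mul_swap (eq_mul_swap_symm h) (by simp) (isCompatible_iff.1 hf).2⟩

theorem interlaced_closure_iff [Finite W] (hM : (T.glue S).IsEulerSystem M)
    (hf : T.IsCompatible M isNegative f g) (v w : V) :
    (T.closure isNegative f g).Interlaced (closedMarks M) (.inl v) (.inl w) ↔
      (T.glue S).Interlaced M (.inl v) (.inl w) := by
  obtain ⟨σ, hσ⟩ := exists_isFirstReturn_returnPerm T S M
  have hv : ∀ v, SameCycle (T.returnPerm (fun v => M (.inl v)) σ) (.inl (v, false))
      (.inl (v, true)) := fun v => hσ.sameCycle_iff.2 (LinkDiagram.isEulerSystem_iff.1 hM (.inl v))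
  refine ((T.isFirstReturn_closedNode M isNegative f g).alternate_iff (x := .inl (v, false))
    (y := .inl (v, true)) (z := .inl (w, false)) (w := .inl (w, true))).symm.trans
    (Iff.trans ?_ (hσ.alternate_iff (x := .inl (v, false)) (y := .inl (v, true))
      (z := .inl (w, false)) (w := .inl (w, true))))
  rcases returnPerm_eq_or_of_isCompatible hf σ with h | ⟨h, hne⟩
  · rw [h]
  · exact alternate_mul_swap_iff h hne (hv v) (by simp) (by simp) (by simp) (by simp) (hv w)

theorem interlaced_closure_inr_iff [Finite W] (hM : (T.glue S).IsEulerSystem M)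
    (hf : T.IsCompatible M isNegative f g) (v : V) :
    (T.closure isNegative f g).Interlaced (closedMarks M) (.inr ()) (.inl v) ↔
      Alternate ((glue T S).circuits M) (.inr (.inl false)) (.inr (.inl true))
        (.inl (.inl v, false)) (.inl (.inl v, true)) := by
  obtain ⟨σ, hσ⟩ := exists_isFirstReturn_returnPerm T S M
  have hv : SameCycle (T.returnPerm (fun v => M (.inl v)) σ) (.inl (v, false))
      (.inl (v, true)) := hσ.sameCycle_iff.2 (LinkDiagram.isEulerSystem_iff.1 hM (.inl v))
  have h1 := (T.isFirstReturn_closedNode M isNegative f g).alternate_iff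
    (x := .inr (f.symm false)) (y := .inr (f.symm true)) (z := .inl (v, false))
    (w := .inl (v, true))
  rw [closedNode_inr_symm, closedNode_inr_symm, alternate_inr_comm f.symm] at h1
  refine h1.symm.trans (Iff.trans ?_ (hσ.alternate_iff (x := .inr false) (y := .inr true)
    (z := .inl (v, false)) (w := .inl (v, true))))
  rcases returnPerm_eq_or_of_isCompatible hf σ with h | ⟨h, hne⟩
  · rw [h]
  -- If the entry points lie on different circuits, `a` has no neighbours. Nor does the new
  -- crossing, since each outside crossing keeps both passages on one of the cycles before merging.
  · refine iff_of_false (fun hn => ?_) fun hn => hne hn.sameCycle.1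
    exact not_alternate_mul_swap h hne hv (by simp) (by simp) (by simp) (by simp)
      (fun _ => .inl rfl) (fun _ => .inr rfl) hn.symm

/-- The circle and the new crossing lie in one component, which accounts for the `+ 1`. It cancels
the `- 1` in the free loops of `interlacementGraph`. -/
theorem natCard_component_closure (hf : T.IsCompatible M isNegative f g) :
    Nat.card (T.closure isNegative f g).Component = (cyclesAvoiding
      (T.returnPerm (fun v => M (.inl v)) (f.trans g)) (Set.range Sum.inr)).ncard + 1 := by
  have hR := T.isFirstReturn_closedNode M isNegative f g
  set D := T.closure isNegative f g with hD
  have hinr : ∀ i, D.component (closedNode f (.inr i)) =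
      D.component (closedNode f (.inr false)) := fun i =>
    D.component_crossing (.inr ()) _ |>.trans (D.component_crossing (.inr ()) _).symm
  have hsurj : ∀ c : D.Component, ∃ x, D.component (closedNode f x) = c := by
    rintro ⟨⟨v | ⟨⟩, s⟩ | i | o⟩
    · exact ⟨.inl (v, s), rfl⟩
    · exact ⟨.inr (f.symm s), congrArg D.component (closedNode_inr_symm f s)⟩
    · exact ⟨.inr i, D.component_next (.inr (.inl i))⟩
    · refine ⟨.inr (f.symm (g.symm o)), ?_⟩
      rw [closedNode_inr_symm, ← D.component_next]
      exact congrArg (fun o => D.component (.inr (.inr o))) (g.apply_symm_apply o)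
  have : Finite D.Component := Quot.finite _
  rw [← D.ncard_component_avoiding hf hR, ← Set.ncard_univ,
    ← Set.ncard_insert_of_notMem (a := D.component (closedNode f (.inr false)))]
  · congr 1
    refine (Set.eq_univ_of_forall fun c => ?_).symm
    by_cases hc : c = D.component (closedNode f (.inr false))
    · exact .inl hc
    · refine .inr ⟨hsurj c, ?_⟩
      rintro _ ⟨i, rfl⟩ h
      exact hc (h.symm.trans (hinr i))
  · rintro ⟨-, h⟩
    exact h (.inr false) ⟨false, rfl⟩ rfl

theorem natCard_outside_component [Finite W] (hM : (T.glue S).IsEulerSystem M) {σ : Equiv.Perm Bool}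
    (hσ : IsFirstReturn ((T.glue S).circuits M) (T.returnPerm (fun v => M (.inl v)) σ)
      outsideNode) :
    Nat.card {c : (glue T S).Component //
      (∃ v : V, (glue T S).component (.inl (.inl v, false)) = c) ∧
        ∀ p, (glue T S).component (.inr p) ≠ c} =
      (cyclesAvoiding (T.returnPerm (fun v => M (.inl v)) σ) (Set.range Sum.inr)).ncard := by
  rw [← (glue T S).ncard_component_avoiding hM hσ]
  change Set.ncard {c | _} = _
  congr 1
  ext c
  constructor
  · rintro ⟨⟨v, hv⟩, hp⟩
    refine ⟨⟨.inl (v, false), hv⟩, ?_⟩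
    rintro _ ⟨i, rfl⟩
    exact hp (.inl i)
  · rintro ⟨⟨x, rfl⟩, hp⟩
    refine ⟨?_, ?_⟩
    · rcases x with ⟨v, s⟩ | i
      · exact ⟨v, ((glue T S).component_crossing (.inl v) s).symm⟩
      · exact absurd rfl (hp (.inr i) ⟨i, rfl⟩)
    · rintro (i | o)
      · exact hp (.inr i) ⟨i, rfl⟩
      -- The exit `o` is not a value of `outsideNode`, but it lies in the component of the entry
      -- `σ.symm o`, which is.
      · have h1 : (glue T S).circuits M (.inr (.inr o)) =
            outsideNode (T.returnPerm (fun v => M (.inl v)) σ (.inr (σ.symm o))) := by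
          have h2 : T.returnPerm (fun v => M (.inl v)) σ (.inr (σ.symm o)) = T.arc (.inr o) :=
            congrArg (fun o => T.arc (.inr o)) (σ.apply_symm_apply o)
          rw [h2]
          rfl
        have h3 : (glue T S).component (outsideNode
            (T.returnPerm (fun v => M (.inl v)) σ (.inr (σ.symm o)))) =
            (glue T S).component (outsideNode (.inr (σ.symm o))) :=
          LinkDiagram.component_eq_of_sameCycle (hσ.sameCycle_iff.1
            (Equiv.Perm.sameCycle_apply_left.2 (SameCycle.refl _ _)))
        rw [← (glue T S).component_circuits M, h1, h3]
        exact hp _ ⟨_, rfl⟩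

theorem natCard_component_closure_eq [Finite W] (hM : (T.glue S).IsEulerSystem M)
    (hf : T.IsCompatible M isNegative f g) :
    Nat.card (T.closure isNegative f g).Component = Nat.card {c : (glue T S).Component //
      (∃ v : V, (glue T S).component (.inl (.inl v, false)) = c) ∧
        ∀ p, (glue T S).component (.inr p) ≠ c} + 1 := by
  obtain ⟨σ, hσ⟩ := exists_isFirstReturn_returnPerm T S M
  rw [natCard_component_closure hf, natCard_outside_component hM hσ]
  rcases returnPerm_eq_or_of_isCompatible hf σ with h | ⟨h, -⟩
  · rw [h]
  · rw [cyclesAvoiding_mul_swap h (Set.mem_range_self false) (Set.mem_range_self true)]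

end Closed

/-- The vertices of the composition of `F` and a single edge. -/
def composeEquiv : V ⊕ Unit ≃ {x : Option V // x ≠ none} ⊕ {w : Unit ⊕ Unit // w ≠ .inl ()} where
  toFun := Sum.map (fun v => ⟨some v, by simp⟩) (fun _ => ⟨.inr (), by simp⟩)
  invFun
    | .inl ⟨some v, _⟩ => .inl v
    | .inl ⟨none, h⟩ => absurd rfl h
    | .inr _ => .inr ()
  left_inv := by rintro (v | ⟨⟩) <;> rfl
  right_inv := by
    rintro (⟨_ | v, h⟩ | ⟨⟨⟩ | ⟨⟩, h⟩)
    · exact absurd rfl h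
    · rfl
    · exact absurd rfl h
    · rfl

/-- The far end of the edge inherits the neighbours of `a`, exactly as the new crossing does, and is
looped when that crossing is negative. -/
theorem bracket_closedGraph [CommRing R] [Fintype V] [Fintype W] (A B d : R) (α β : V → R)
    (hM : (T.glue S).IsEulerSystem M) {isNegative : Prop} {f g : Equiv.Perm Bool}
    (hf : T.IsCompatible M isNegative f g) :
    (T.closedGraph M isNegative f g A B α β).bracket d =
      ((T.outsideGraph S M A B α β).compose none (MarkedGraph.pendant isNegative A B)
        (.inl ())).bracket d := by
  have hnew : ∀ v, (T.closedGraph M isNegative f g A B α β).graph.Adj (.inl v) (.inr ()) ↔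
      (T.outsideGraph S M A B α β).graph.Adj (some v) none := by
    intro v
    have h1 := interlaced_closure_inr_iff hM hf v
    have h2 : (T.closure isNegative f g).Interlaced (closedMarks M) (.inl v) (.inr ()) ↔
        (T.closure isNegative f g).Interlaced (closedMarks M) (.inr ()) (.inl v) :=
      alternate_comm
    simp [closedGraph, LinkDiagram.interlacementGraph, outsideGraph, h1, h2]
  refine MarkedGraph.bracket_congr d composeEquiv ?_ ?_ ?_ ?_ ?_ ?_
  · rintro (v | ⟨⟩) (w | ⟨⟩)
    · have h1 := interlaced_closure_iff hM hf v w
      have h2 := interlaced_closure_iff hM hf w v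
      simp [closedGraph, LinkDiagram.interlacementGraph, outsideGraph, h1, h2, composeEquiv,
        MarkedGraph.compose]
    · rw [hnew]
      exact ⟨fun h => h.1, fun h => ⟨h, trivial, trivial⟩⟩
    · rw [SimpleGraph.adj_comm, SimpleGraph.adj_comm _ (Sum.inr _), hnew]
      exact ⟨fun h => h.1, fun h => ⟨h, trivial, trivial⟩⟩
    · exact iff_of_false (SimpleGraph.irrefl _) (SimpleGraph.irrefl _)
  · rintro (v | ⟨⟩)
    · exact ⟨fun ⟨w, hw, h⟩ => Option.some.inj hw ▸ h, fun h => ⟨v, rfl, h⟩⟩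
    · exact Iff.rfl
  · rintro (v | ⟨⟩)
    · exact ⟨fun ⟨w, hw, h⟩ => Option.some.inj hw ▸ h, fun h => ⟨v, rfl, h⟩⟩
    · exact iff_of_false not_false Bool.false_ne_true
  · rintro (v | ⟨⟩) <;> rfl
  · rintro (v | ⟨⟩) <;> rfl
  · have h := natCard_component_closure_eq hM hf
    simp only [MarkedGraph.compose, outsideGraph, MarkedGraph.pendant, MarkedGraph.join,
      MarkedGraph.single, closedGraph, LinkDiagram.interlacementGraph, h]
    simp only [closure, glue, oneCrossing]
    omega

end Tangle

end Circuits

theorem corollary9 {R V W : Type*} [CommRing R] [Fintype V] [Fintype W]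
    (A B d : R) (α β : V → R) (T : Tangle V) (S : Tangle W) (M : V ⊕ W → Bool)
    (hM : (T.glue S).IsEulerSystem M) :
    (∃ x y z : R, (T.outsideGraph S M A B α β).IsJoinWeights A B d none x y z) ∧
    (∀ isNegative : Prop, ∃ f g : Equiv.Perm Bool, T.IsCompatible M isNegative f g) ∧
    ∀ x y z : R, (T.outsideGraph S M A B α β).IsJoinWeights A B d none x y z →
      ∀ f₁ g₁ f₂ g₂ : Equiv.Perm Bool,
        T.IsCompatible M False f₁ g₁ → T.IsCompatible M True f₂ g₂ →
        ∀ F₀ F₁ F₂ : R,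
          F₀ = ((T.outsideGraph S M A B α β).delete none).bracket d →
          F₁ = (T.closedGraph M False f₁ g₁ A B α β).bracket d →
          F₂ = (T.closedGraph M True f₂ g₂ A B α β).bracket d →
          ((A + B) * ((2 - d - d ^ 2) * x) = (A + B) * (-(d + 1) * F₀) + (F₁ + F₂) ∧
            (A ^ 2 - B ^ 2) * ((2 - d - d ^ 2) * y) =
              (A ^ 2 - B ^ 2) * F₀ + ((A + B + B * d) * F₁ - (A + A * d + B) * F₂) ∧
            (A ^ 2 - B ^ 2) * ((2 - d - d ^ 2) * z) =
              (A ^ 2 - B ^ 2) * F₀ + ((A + B + B * d) * F₂ - (A + A * d + B) * F₁)) ∧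
          (∀ u : Rˣ, (u : R) = A + B →
            (2 - d - d ^ 2) * x = -(d + 1) * F₀ + (F₁ + F₂) /ₚ u) ∧
          (∀ u : Rˣ, (u : R) = A ^ 2 - B ^ 2 →
            (2 - d - d ^ 2) * y =
                F₀ + ((A + B + B * d) * F₁ - (A + A * d + B) * F₂) /ₚ u ∧
              (2 - d - d ^ 2) * z =
                F₀ + ((A + B + B * d) * F₂ - (A + A * d + B) * F₁) /ₚ u) := by
  refine ⟨MarkedGraph.exists_isJoinWeights A B d _ none,
    fun isNegative => Tangle.exists_isCompatible hM isNegative, ?_⟩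
  intro x y z h f₁ g₁ f₂ g₂ h₁ h₂ F₀ F₁ F₂ hF₀ hF₁ hF₂
  rw [Tangle.bracket_closedGraph A B d α β hM h₁, h.bracket_compose_pendant_false] at hF₁
  rw [Tangle.bracket_closedGraph A B d α β hM h₂, h.bracket_compose_pendant_true] at hF₂
  rw [h.bracket_delete] at hF₀
  subst hF₀ hF₁ hF₂
  -- `F₁ + F₂` involves `y`, `z` only through `y + z`, which `F₀` eliminates and leaves `2 - d * (d
  -- + 1)` on `x`. In the other two combinations, `x` and the remaining unknown cancel against `(A ^
  -- 2 - B ^ 2) * F₀`.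
  refine ⟨⟨by ring, by ring, by ring⟩, fun u hu => ?_, fun u hu => ⟨?_, ?_⟩⟩
  · rw [← sub_eq_iff_eq_add', eq_comm, divp_eq_iff_mul_eq, hu]
    ring
  · rw [← sub_eq_iff_eq_add', eq_comm, divp_eq_iff_mul_eq, hu]
    ring
  · rw [← sub_eq_iff_eq_add', eq_comm, divp_eq_iff_mul_eq, hu]
    ring
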